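/- Let $G$ be a group that is the amalgamated product $G=G_1*_ZG_2$ of subgroups $G_1,G_2$ over a common subgroup $Z$, where $G_1\neq Z\neq G_2$ and $Z$ is virtually $\mathbb{Z}$ (i.e. has an infinite cyclic subgroup of finite index). Let $G$ act geometrically, i.e. by isometries, properly ($\{g\in G: gK\cap K\neq\emptyset\}$ is finite for every compact $K\subseteq X$) and cocompactly (the quotient $G\backslash X$ is compact), on a non-empty proper metric space $(X,d)$. Let $\sigma\colon X\times X\times[0,1]\to X$ be a geodesic bicombing, that is, a continuous map such that each $\sigma_{xy}=\sigma(x,y,\cdot)$ is a constant speed geodesic from $x$ to $y$. Assume that $\sigma$ is $\mathfrak{ccc}$, i.e. consistent ($\mathrm{im}\,\sigma_{\sigma_{xy}(s),\sigma_{xy}(t)}=\sigma_{xy}([s,t])$ for all $x,y\in X$ and $0\le s<t\le 1$) and conical ($d(\sigma_{xy}(t),\sigma_{x'y'}(t))\le(1-t)d(x,x')+t\,d(y,y')$ for all $x,y,x',y'\in X$ and $t\in[0,1]$), and hence convex, i.e. $t\mapsto d(\sigma_{xy}(t),\sigma_{x'y'}(t))$ is convex; that it is reversible ($\sigma_{xy}(t)=\sigma_{yx}(1-t)$);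 and that it is $G$-equivariant ($g\,\sigma_{xy}(t)=\sigma_{gx,gy}(t)$ for all $g\in G$). A $\sigma$-ray is an isometric embedding $\xi\colon[0,\infty)\to X$ with $\mathrm{im}\,\sigma_{\xi(0)\xi(t)}=\xi([0,t])$ for all $t\ge 0$; two $\sigma$-rays $\xi,\zeta$ are asymptotic if $\sup_{t\ge 0}d(\xi(t),\zeta(t))<\infty$. The boundary $\partial_\sigma X$ is the set of asymptoty classes of $\sigma$-rays. For a basepoint $o\in X$, its topology is generated by the sets $$\{[\eta] : \eta \text{ a }\sigma\text{-ray},\ \eta(0)=o,\ d(\eta(t),\xi(t))<\epsilon\},$$ where $\xi$ is a $\sigma$-ray with $\xi(0)=o$, $t\ge 0$ and $\epsilon>0$; this topology does not depend on $o$. Then there exists a separating pair of points in $\partial_\sigma X$, i.e. there are two distinct points $a,b\in\partial_\sigma X$ such that $\partial_\sigma X\setminus\{a,b\}$ is disconnected. -/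

import Mathlib

open scoped NNReal

section GeometricAction

/-- An action of a (discrete) group on a metric space is geometric if it is by isometries, proper
(only finitely many translates of a compact set `K` meet `K`) and cocompact (the orbit space is
compact). -/
structure IsGeometricAction (G : Type*) (X : Type*) [Group G] [MetricSpace X] [MulAction G X] :
    Prop where
  isometric : ∀ g : G, Isometry fun x : X => g • x
  proper : ∀ K : Set X, IsCompact K → {g : G | ((fun x => g • x) '' K ∩ K).Nonempty}.Finite
  cocompact : CompactSpace (Quotient (MulAction.orbitRel G X))

end GeometricAction

section Groups

/-- A group is virtually `ℤ` if it has an infinite cyclic subgroup of finite index. -/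
def IsVirtuallyInt (Z : Type*) [Group Z] : Prop :=
  ∃ M : Subgroup Z, M.FiniteIndex ∧ Nonempty (M ≃* Multiplicative ℤ)

/-- The canonical homomorphism from the amalgamated product `A 0 *_Z A 1` (the pushout of the
inclusions `Z ↪ A 0` and `Z ↪ A 1`) to `G`, for subgroups `A 0`, `A 1` of `G` that contain the
subgroup `Z`. -/
def amalgamMap {G : Type*} [Group G] (A : Fin 2 → Subgroup G) (Z : Subgroup G)
    (h : ∀ i, Z ≤ A i) : Monoid.PushoutI (fun i => Subgroup.inclusion (h i)) →* G :=
  Monoid.PushoutI.lift (fun i => (A i).subtype) Z.subtype fun _ => rfl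

/-- `G = G₁ *_Z G₂`: the subgroup `Z` is contained in the subgroups `G₁` and `G₂` of `G`, and the
canonical homomorphism from the amalgamated product of `G₁` and `G₂` over `Z` to `G` is an
isomorphism. -/
def IsAmalgamatedProduct {G : Type*} [Group G] (G₁ G₂ Z : Subgroup G) : Prop :=
  ∃ h : ∀ i, Z ≤ ![G₁, G₂] i, Function.Bijective (amalgamMap ![G₁, G₂] Z h)

end Groups

section Bicombings

/-- A (geodesic) bicombing on `X`: a continuous map `σ : X × X × [0,1] → X` such that each
`σ x y` is a constant speed geodesic from `x` to `y`. -/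
structure Bicombing (X : Type*) [MetricSpace X] where
  toFun : X → X → unitInterval → X
  continuous_toFun : Continuous fun p : X × X × unitInterval => toFun p.1 p.2.1 p.2.2
  map_zero : ∀ x y, toFun x y 0 = x
  map_one : ∀ x y, toFun x y 1 = y
  dist_map : ∀ x y (s t : unitInterval),
    dist (toFun x y s) (toFun x y t) = |(s : ℝ) - (t : ℝ)| * dist x y

namespace Bicombing

variable {X : Type*} [MetricSpace X]

instance : CoeFun (Bicombing X) fun _ => X → X → unitInterval → X := ⟨Bicombing.toFun⟩

/-- The `σ`-geodesic between two points of a `σ`-geodesic is the part of it between them. -/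
def IsConsistent (σ : Bicombing X) : Prop :=
  ∀ (x y : X) (s t : unitInterval), s < t →
    Set.range (σ (σ x y s) (σ x y t)) = σ x y '' Set.Icc s t

def IsConical (σ : Bicombing X) : Prop :=
  ∀ (x y x' y' : X) (t : unitInterval),
    dist (σ x y t) (σ x' y' t) ≤ (1 - (t : ℝ)) * dist x x' + (t : ℝ) * dist y y'

/-- A ccc bicombing: consistent and conical. (Such a bicombing is automatically convex.) -/
def IsCCC (σ : Bicombing X) : Prop := σ.IsConsistent ∧ σ.IsConical

def IsReversible (σ : Bicombing X) : Prop :=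
  ∀ (x y : X) (t : unitInterval), σ x y t = σ y x (unitInterval.symm t)

def IsEquivariant (σ : Bicombing X) (G : Type*) [Group G] [MulAction G X] : Prop :=
  ∀ (g : G) (x y : X) (t : unitInterval), g • σ x y t = σ (g • x) (g • y) t

/-- A `σ`-ray: an isometric embedding `ξ : [0,∞) → X` whose initial segments are, as sets,
`σ`-geodesics. -/
structure Ray (σ : Bicombing X) where
  toFun : ℝ≥0 → X
  isometry : Isometry toFun
  range_eq : ∀ t : ℝ≥0, Set.range (σ (toFun 0) (toFun t)) = toFun '' Set.Icc 0 t

instance (σ : Bicombing X) : CoeFun σ.Ray fun _ => ℝ≥0 → X := ⟨Ray.toFun⟩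

/-- Two `σ`-rays are asymptotic if they stay at bounded distance from each other. -/
def asymptotic (σ : Bicombing X) : Setoid σ.Ray where
  r ξ ζ := ∃ C : ℝ, ∀ t : ℝ≥0, dist (ξ t) (ζ t) ≤ C
  iseqv :=
    { refl := fun _ => ⟨0, fun _ => (dist_self _).le⟩
      symm := fun ⟨C, h⟩ => ⟨C, fun t => (dist_comm _ _).trans_le (h t)⟩
      trans := fun ⟨C, h⟩ ⟨D, k⟩ =>
        ⟨C + D, fun t => (dist_triangle _ _ _).trans (add_le_add (h t) (k t))⟩ }

/-- The boundary `∂_σ X`, as a set: the asymptoty classes of `σ`-rays. -/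
def Boundary (σ : Bicombing X) : Type _ := Quotient σ.asymptotic

/-- The asymptoty class of a `σ`-ray. -/
def Ray.toBoundary {σ : Bicombing X} (ξ : σ.Ray) : σ.Boundary := Quotient.mk σ.asymptotic ξ

/-- The basic set `U_o([ξ], t, ε)`, where `ξ` is a `σ`-ray and `o = ξ 0`: the boundary points whose
representative `η` issuing from `o` satisfies `dist (η t) (ξ t) < ε`. -/
def basicNhd (σ : Bicombing X) (ξ : σ.Ray) (t : ℝ≥0) (ε : ℝ) : Set σ.Boundary :=
  {b | ∃ η : σ.Ray, η 0 = ξ 0 ∧ η.toBoundary = b ∧ dist (η t) (ξ t) < ε}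

/-- The topology of `∂_σ X`, constructed from the basepoint `o`. -/
@[reducible] def boundaryTopology (σ : Bicombing X) (o : X) : TopologicalSpace σ.Boundary :=
  TopologicalSpace.generateFrom
    {U | ∃ (ξ : σ.Ray) (t : ℝ≥0) (ε : ℝ), ξ 0 = o ∧ 0 < ε ∧ U = σ.basicNhd ξ t ε}

end Bicombing

end Bicombings

/-- `a`, `b` is a separating pair of points of the topological space `(T, τ)`: they are distinct and
the complement of `{a, b}` is disconnected. -/
def IsSeparatingPair {T : Type*} (τ : TopologicalSpace T) (a b : T) : Prop :=
  a ≠ b ∧ ¬ @IsPreconnected T τ ({a, b}ᶜ)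

/-! The separating pair consists of the two ends of an axis of `Z`: some `γ ∈ Z` generates an
infinite cyclic subgroup of finite index in `Z` and translates a `σ`-line.

Let `U` be the set of elements of `G` whose normal form begins in `G₁ \ Z`. Right multiplication by
a fixed element changes membership in `U` only inside `Z * F` with `F` finite. Hence the thickened
orbit pieces of `U` and `Uᶜ` cover `X` and come close to each other only near the axis
(`exists_separatedOff`). A `σ`-ray that has left a large neighbourhood of the axis never returns,
since the distance to a line is quasi-convex, so it stays on one side from then on. The ends on
either side form an open set (`isOpen_endsIn`). The two sets are disjoint, as a boundary point has
only one ray from `o`, and they miss only the ends of the axis, as a ray that stays near a line is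
asymptotic to one of its halves. Neither is empty: for `a ∈ G₁ \ Z` and `b ∈ G₂ \ Z` the positive
powers of `a * b` lie in `U`, those of `b * a` in `Uᶜ`, none in `Z`, so the axes of these elements
diverge from that of `Z` on either side (`exists_diverging_ray`).

Axes (`exists_axis`) come from fixed points of the map sending `y` to the midpoint of `g⁻¹ • y` and
`g • y`. This map is only 1-Lipschitz. Shrinking it towards `o` gives approximate fixed points, with
an error controlled by a random walk estimate; properness and cocompactness make them exact. The
orbit of a fixed point is a local geodesic, and conicality forces it onto a `σ`-line. -/

namespace Bicombing

/-! ### Geodesics of a bicombing -/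

variable {X : Type*} [MetricSpace X]

/-- The `σ`-geodesic from `x` to `y`, parametrized by the real numbers, constant outside `[0,1]`. -/
noncomputable def seg (σ : Bicombing X) (x y : X) (t : ℝ) : X := σ x y (Set.projIcc 0 1 zero_le_one t)

variable (σ : Bicombing X)

theorem seg_of_mem {t : ℝ} (x y : X) (ht : t ∈ Set.Icc (0 : ℝ) 1) :
    σ.seg x y t = σ x y ⟨t, ht⟩ := by
  rw [seg, Set.projIcc_of_mem _ ht]

@[simp] theorem seg_zero (x y : X) : σ.seg x y 0 = x := by
  rw [seg, Set.projIcc_left]; exact σ.map_zero x y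

@[simp] theorem seg_one (x y : X) : σ.seg x y 1 = y := by
  rw [seg, Set.projIcc_right]; exact σ.map_one x y

theorem continuous_seg {Y : Type*} [TopologicalSpace Y] {f g : Y → X} {h : Y → ℝ}
    (hf : Continuous f) (hg : Continuous g) (hh : Continuous h) :
    Continuous fun p => σ.seg (f p) (g p) (h p) :=
  σ.continuous_toFun.comp (hf.prodMk (hg.prodMk ((continuous_projIcc (h := zero_le_one)).comp hh)))

theorem dist_seg_seg (x y : X) {s t : ℝ} (hs : s ∈ Set.Icc (0 : ℝ) 1)
    (ht : t ∈ Set.Icc (0 : ℝ) 1) :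
    dist (σ.seg x y s) (σ.seg x y t) = |s - t| * dist x y := by
  rw [σ.seg_of_mem x y hs, σ.seg_of_mem x y ht]; exact σ.dist_map _ _ _ _

theorem dist_left_seg (x y : X) {t : ℝ} (ht : t ∈ Set.Icc (0 : ℝ) 1) :
    dist x (σ.seg x y t) = t * dist x y := by
  have := σ.dist_seg_seg x y (s := 0) (by simp) ht
  rwa [seg_zero, zero_sub, abs_neg, abs_of_nonneg ht.1] at this

theorem dist_seg_right (x y : X) {t : ℝ} (ht : t ∈ Set.Icc (0 : ℝ) 1) :
    dist (σ.seg x y t) y = (1 - t) * dist x y := by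
  have := σ.dist_seg_seg x y (t := 1) ht (by simp)
  rwa [seg_one, abs_sub_comm, abs_of_nonneg (by linarith [ht.2])] at this

theorem seg_self (x : X) {t : ℝ} (ht : t ∈ Set.Icc (0 : ℝ) 1) : σ.seg x x t = x := by
  have := σ.dist_left_seg x x ht
  rw [dist_self, mul_zero, dist_eq_zero] at this
  exact this.symm

variable {σ}

theorem IsConical.dist_seg_le (hσ : σ.IsConical) (x y x' y' : X) {t : ℝ}
    (ht : t ∈ Set.Icc (0 : ℝ) 1) :
    dist (σ.seg x y t) (σ.seg x' y' t) ≤ (1 - t) * dist x x' + t * dist y y' := by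
  rw [σ.seg_of_mem x y ht, σ.seg_of_mem x' y' ht]; exact hσ _ _ _ _ _

theorem IsReversible.seg_symm (hσ : σ.IsReversible) (x y : X) {t : ℝ}
    (ht : t ∈ Set.Icc (0 : ℝ) 1) : σ.seg x y t = σ.seg y x (1 - t) := by
  have ht' : 1 - t ∈ Set.Icc (0 : ℝ) 1 := ⟨by linarith [ht.2], by linarith [ht.1]⟩
  rw [σ.seg_of_mem x y ht, σ.seg_of_mem y x ht', hσ]; rfl

theorem IsEquivariant.smul_seg {G : Type*} [Group G] [MulAction G X] (hσ : σ.IsEquivariant G)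
    (g : G) (x y : X) (t : ℝ) : g • σ.seg x y t = σ.seg (g • x) (g • y) t :=
  hσ g x y _

/-- Consistency equates images only; the distance to the starting point determines the parameter. -/
theorem IsConsistent.seg_seg (hσ : σ.IsConsistent) (x y : X) {a b t : ℝ}
    (ha : 0 ≤ a) (hab : a ≤ b) (hb : b ≤ 1) (ht : t ∈ Set.Icc (0 : ℝ) 1) :
    σ.seg (σ.seg x y a) (σ.seg x y b) t = σ.seg x y (a + t * (b - a)) := by
  rcases hab.eq_or_lt with rfl | hab'
  · simp [σ.seg_self _ ht]
  have ha' : a ∈ Set.Icc (0 : ℝ) 1 := ⟨ha, by linarith⟩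
  have hb' : b ∈ Set.Icc (0 : ℝ) 1 := ⟨by linarith, hb⟩
  have hw : a + t * (b - a) ∈ Set.Icc (0 : ℝ) 1 := by
    constructor <;> nlinarith [ht.1, ht.2]
  have hmem : σ.seg (σ.seg x y a) (σ.seg x y b) t ∈
      σ x y '' Set.Icc (⟨a, ha'⟩ : unitInterval) ⟨b, hb'⟩ := by
    rw [← hσ x y ⟨a, ha'⟩ ⟨b, hb'⟩ hab', ← σ.seg_of_mem x y ha', ← σ.seg_of_mem x y hb']
    exact ⟨_, rfl⟩
  obtain ⟨w, ⟨hw1, hw2⟩, hwe⟩ := hmem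
  have hwe' : σ.seg x y w = σ.seg (σ.seg x y a) (σ.seg x y b) t := by
    rw [← hwe, σ.seg_of_mem x y w.2]
  have h1 := σ.dist_left_seg (σ.seg x y a) (σ.seg x y b) ht
  have hw1' : a ≤ w := hw1
  rw [← hwe', σ.dist_seg_seg x y ha' w.2, σ.dist_seg_seg x y ha' hb', abs_sub_comm,
    abs_sub_comm a b, abs_of_nonneg (by linarith), abs_of_pos (by linarith)] at h1
  rw [← hwe', ← dist_eq_zero, σ.dist_seg_seg x y w.2 hw]
  rcases (dist_nonneg (x := x) (y := y)).eq_or_lt with h0 | h0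
  · rw [← h0, mul_zero]
  · have : (w : ℝ) - a = t * (b - a) := by
      apply mul_right_cancel₀ h0.ne'; linarith
    rw [show (w : ℝ) - (a + t * (b - a)) = 0 by linarith, abs_zero, zero_mul]

/-! ### Rays and asymptoty -/

namespace Ray

theorem dist_eq (ξ : σ.Ray) (s t : ℝ≥0) : dist (ξ s) (ξ t) = |(s : ℝ) - t| := by
  rw [ξ.isometry.dist_eq, NNReal.dist_eq]

theorem seg_zero_eq (ξ : σ.Ray) {s t : ℝ≥0} (hst : s ≤ t) (ht : 0 < t) :
    σ.seg (ξ 0) (ξ t) (s / t) = ξ s := by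
  have hu : (s / t : ℝ) ∈ Set.Icc (0 : ℝ) 1 :=
    ⟨by positivity, div_le_one_of_le₀ (by exact_mod_cast hst) t.2⟩
  have hmem : σ.seg (ξ 0) (ξ t) (s / t) ∈ ξ.toFun '' Set.Icc 0 t := by
    rw [← ξ.range_eq]; exact ⟨_, rfl⟩
  obtain ⟨w, -, hw⟩ := hmem
  have h1 := σ.dist_left_seg (ξ 0) (ξ t) hu
  rw [← hw, ξ.dist_eq, ξ.dist_eq] at h1
  have ht' : (t : ℝ) ≠ 0 := by exact_mod_cast ht.ne'
  simp only [NNReal.coe_zero, zero_sub, abs_neg, NNReal.abs_eq] at h1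
  rw [div_mul_cancel₀ _ ht'] at h1
  rw [← hw, show w = s by exact_mod_cast h1]

theorem dist_le (hσ : σ.IsConical) (ξ η : σ.Ray) {s t : ℝ≥0} (hst : s ≤ t) (ht : 0 < t) :
    dist (ξ s) (η s) ≤ (1 - s / t) * dist (ξ 0) (η 0) + s / t * dist (ξ t) (η t) := by
  have hu : (s / t : ℝ) ∈ Set.Icc (0 : ℝ) 1 :=
    ⟨by positivity, div_le_one_of_le₀ (by exact_mod_cast hst) t.2⟩
  rw [← ξ.seg_zero_eq hst ht, ← η.seg_zero_eq hst ht]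
  exact hσ.dist_seg_le _ _ _ _ hu

/-- Two rays that are close at arbitrarily large times are asymptotic. -/
theorem dist_le_of_frequently (hσ : σ.IsConical) (ξ η : σ.Ray) {C : ℝ}
    (hC : dist (ξ 0) (η 0) ≤ C) (h : ∀ s : ℝ≥0, ∃ t, s ≤ t ∧ dist (ξ t) (η t) ≤ C) (s : ℝ≥0) :
    dist (ξ s) (η s) ≤ C := by
  obtain ⟨t, hst, ht⟩ := h (s + 1)
  have hst' : s ≤ t := le_trans (by simp) hst
  have ht0 : 0 < t := lt_of_lt_of_le (by positivity) hst
  have hu : (s / t : ℝ) ∈ Set.Icc (0 : ℝ) 1 :=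
    ⟨by positivity, div_le_one_of_le₀ (by exact_mod_cast hst') t.2⟩
  nlinarith [ξ.dist_le hσ η hst' ht0, hu.1, hu.2]

/-- Conicality bounds the distance at time `s` by `s / t * C` for every `t ≥ s`; let `t` tend to
infinity. -/
theorem eq_of_asymptotic (hσ : σ.IsConical) (ξ η : σ.Ray) (h0 : ξ 0 = η 0)
    (h : ξ.toBoundary = η.toBoundary) (s : ℝ≥0) : ξ s = η s := by
  obtain ⟨C, hC⟩ : ∃ C : ℝ, ∀ t : ℝ≥0, dist (ξ t) (η t) ≤ C := Quotient.exact h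
  have hC0 : 0 ≤ C := dist_nonneg.trans (hC 0)
  rw [← dist_eq_zero]
  refine le_antisymm (le_of_forall_pos_le_add fun ε hε => ?_) dist_nonneg
  rw [zero_add]
  set t : ℝ≥0 := s + 1 + Real.toNNReal (s * C / ε) with ht
  have htpos : 0 < t := by positivity
  have h1 := ξ.dist_le hσ η (show s ≤ t by rw [ht, add_assoc]; simp) htpos
  rw [h0, dist_self, mul_zero, zero_add] at h1
  refine h1.trans ?_
  have h2 : s * C / ε ≤ t := by
    rw [ht]; push_cast
    have := Real.le_coe_toNNReal (s * C / ε)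
    have := s.2
    linarith
  have htpos' : (0 : ℝ) < t := by exact_mod_cast htpos
  rw [div_mul_eq_mul_div, div_le_iff₀ htpos']
  rw [div_le_iff₀ hε] at h2
  have h3 := mul_le_mul_of_nonneg_left (hC t) s.coe_nonneg
  linarith

/-- A unit speed `σ`-geodesic half line, parametrized by the reals, defines a ray. -/
def ofReal (σ : Bicombing X) (f : ℝ → X)
    (hf : ∀ s t : ℝ, 0 ≤ s → 0 ≤ t → dist (f s) (f t) = |s - t|)
    (hseg : ∀ t : ℝ, 0 ≤ t → ∀ u ∈ Set.Icc (0 : ℝ) 1, σ.seg (f 0) (f t) u = f (u * t)) : σ.Ray where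
  toFun t := f t
  isometry := Isometry.of_dist_eq fun s t => by rw [hf s t s.2 t.2, NNReal.dist_eq]
  range_eq t := by
    ext x
    constructor
    · rintro ⟨u, rfl⟩
      have h := hseg t t.2 u u.2
      rw [σ.seg_of_mem _ _ u.2] at h
      refine ⟨⟨u * t, mul_nonneg u.2.1 t.2⟩, ⟨zero_le, ?_⟩, ?_⟩
      · change (u * t : ℝ) ≤ t
        nlinarith [u.2.2, t.2]
      · change f (u * t) = _
        rw [← h]; rfl
    · rintro ⟨s, ⟨-, hs⟩, rfl⟩
      have hs' : (s : ℝ) ≤ t := hs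
      rcases (t.2 : (0 : ℝ) ≤ t).eq_or_lt with h0 | h0
      · have : s = 0 := by
          apply le_antisymm _ zero_le
          change (s : ℝ) ≤ 0
          rw [h0]; exact hs'
        refine ⟨0, ?_⟩
        rw [σ.map_zero, this]
      · have hu : (s / t : ℝ) ∈ Set.Icc (0 : ℝ) 1 :=
          ⟨div_nonneg s.2 t.2, div_le_one_of_le₀ hs' t.2⟩
        have h := hseg t t.2 _ hu
        rw [σ.seg_of_mem _ _ hu, show (s / t * t : ℝ) = s from div_mul_cancel₀ _ h0.ne'] at h
        exact ⟨_, h⟩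

/-- From every point there starts a ray asymptotic to a given one. -/
theorem exists_asymptotic [CompleteSpace X] (hσ : σ.IsCCC) (ξ : σ.Ray) (o : X) :
    ∃ η : σ.Ray, η 0 = o ∧ ∀ t : ℝ≥0, dist (η t) (ξ t) ≤ dist o (ξ 0) := by
  obtain ⟨hcons, hcon⟩ := hσ
  set D := dist o (ξ 0) with hD
  have hD0 : 0 ≤ D := dist_nonneg
  -- The geodesic from `o` to `ξ n`, parametrized by `[0, n]` rather than by arc length. Its speed
  -- `dist o (ξ n) / n` tends to `1`, so the limit in `n` has unit speed.
  let e : ℕ → ℝ → X := fun n s => σ.seg o (ξ n) (s / n)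
  have mem : ∀ {n : ℕ} {s : ℝ}, 0 ≤ s → s ≤ n → s / n ∈ Set.Icc (0 : ℝ) 1 := fun {n s} h0 h1 =>
    ⟨by positivity, div_le_one_of_le₀ h1 (by positivity)⟩
  have near : ∀ (n : ℕ) (s : ℝ≥0), s ≤ n → dist (e n s) (ξ s) ≤ D := by
    intro n s hs
    have hs' : (s : ℝ) ≤ n := by exact_mod_cast hs
    rcases n.eq_zero_or_pos with rfl | hn
    · have : s = 0 := by simpa using hs
      simp [e, this, hD]
    have hu := mem s.2 hs'
    have h1 := ξ.seg_zero_eq hs (by exact_mod_cast hn)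
    rw [NNReal.coe_natCast] at h1
    rw [← h1]
    refine (hcon.dist_seg_le o (ξ n) (ξ 0) (ξ n) hu).trans ?_
    rw [dist_self, mul_zero, add_zero, ← hD]
    nlinarith [hu.1]
  have nest : ∀ (n : ℕ) (t u : ℝ), 0 ≤ t → t ≤ n → u ∈ Set.Icc (0 : ℝ) 1 →
      σ.seg o (e n t) u = e n (u * t) := by
    intro n t u h0 h1 hu
    have := hcons.seg_seg o (ξ n) (le_refl 0) (mem h0 h1).1 (mem h0 h1).2 hu
    rw [seg_zero] at this
    simp only [e]
    rw [this]; congr 1; ring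
  -- Up to time `n`, `e m` is the geodesic from `o` to `e m n`, whose endpoint is within `D` of `ξ
  -- n`, the endpoint of `e n`.
  have cauchy : ∀ (n m : ℕ) (s : ℝ), 0 < n → n ≤ m → 0 ≤ s → s ≤ n →
      dist (e m s) (e n s) ≤ s * D / n := by
    intro n m s hn hnm h0 h1
    have hn' : (0 : ℝ) < n := by exact_mod_cast hn
    have h2 := nest m n (s / n) hn'.le (by exact_mod_cast hnm) (mem h0 h1)
    rw [div_mul_cancel₀ _ hn'.ne'] at h2
    rw [← h2]
    refine (hcon.dist_seg_le o _ o _ (mem h0 h1)).trans ?_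
    rw [dist_self, mul_zero, zero_add, div_mul_eq_mul_div]
    have := near m n (by exact_mod_cast hnm)
    simp only [NNReal.coe_natCast] at this
    gcongr
  have lim : ∀ s : ℝ, ∃ x, 0 ≤ s → Filter.Tendsto (fun n => e n s) Filter.atTop (nhds x) := by
    intro s
    by_cases h0 : 0 ≤ s
    swap
    · exact ⟨o, fun h => absurd h h0⟩
    suffices CauchySeq fun n => e n s by
      obtain ⟨x, hx⟩ := cauchySeq_tendsto_of_complete this
      exact ⟨x, fun _ => hx⟩
    refine Metric.cauchySeq_iff'.2 fun ε hε => ?_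
    obtain ⟨N, hN⟩ := exists_nat_gt (max s (s * D / ε))
    have hN1 := (le_max_left _ _).trans_lt hN
    have hN2 := (le_max_right _ _).trans_lt hN
    have hN0 : (0 : ℝ) < N := h0.trans_lt hN1
    refine ⟨N, fun n hn => (cauchy N n s (by exact_mod_cast hN0) hn h0 hN1.le).trans_lt ?_⟩
    rw [div_lt_iff₀ hε] at hN2
    rw [div_lt_iff₀ hN0]; linarith
  choose f hf using lim
  have ev : ∀ s : ℝ, ∀ᶠ n : ℕ in Filter.atTop, s ≤ n := fun s =>
    (Filter.eventually_ge_atTop ⌈s⌉₊).mono fun n hn => (Nat.le_ceil s).trans (by exact_mod_cast hn)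
  have hf0 : f 0 = o := by
    refine tendsto_nhds_unique (hf 0 le_rfl) ?_
    simp [e]
  have hdist : ∀ s t : ℝ, 0 ≤ s → 0 ≤ t → dist (f s) (f t) = |s - t| := by
    intro s t hs ht
    refine tendsto_nhds_unique ((hf s hs).dist (hf t ht)) ?_
    have h1 : Filter.Tendsto (fun n : ℕ => |s - t| * (1 + D / n)) Filter.atTop (nhds |s - t|) := by
      simpa using ((tendsto_const_div_atTop_nhds_zero_nat D).const_add 1).const_mul |s - t|
    have h2 : Filter.Tendsto (fun n : ℕ => |s - t| * (1 - D / n)) Filter.atTop (nhds |s - t|) := by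
      simpa using ((tendsto_const_div_atTop_nhds_zero_nat D).const_sub 1).const_mul |s - t|
    have key : ∀ᶠ n : ℕ in Filter.atTop,
        dist (e n s) (e n t) = |s - t| * (dist o (ξ n) / n) ∧ (0 : ℝ) < n := by
      filter_upwards [ev s, ev t, Filter.eventually_gt_atTop 0] with n h3 h4 h5
      have hn : (0 : ℝ) < n := by exact_mod_cast h5
      refine ⟨?_, hn⟩
      simp only [e]
      rw [σ.dist_seg_seg _ _ (mem hs h3) (mem ht h4), ← sub_div, abs_div, abs_of_pos hn]
      ring
    have hξ : ∀ n : ℕ, dist (ξ 0) (ξ n) = n := fun n => by simp [ξ.dist_eq]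
    refine tendsto_of_tendsto_of_tendsto_of_le_of_le' h2 h1 ?_ ?_
    · filter_upwards [key] with n ⟨h, hn⟩
      rw [h]
      refine mul_le_mul_of_nonneg_left ?_ (abs_nonneg _)
      rw [le_div_iff₀ hn, sub_mul, div_mul_cancel₀ _ hn.ne', one_mul]
      have := dist_triangle (ξ 0) o (ξ n)
      rw [hξ, dist_comm _ o] at this
      linarith
    · filter_upwards [key] with n ⟨h, hn⟩
      rw [h]
      refine mul_le_mul_of_nonneg_left ?_ (abs_nonneg _)
      rw [div_le_iff₀ hn, add_mul, div_mul_cancel₀ _ hn.ne', one_mul]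
      have := dist_triangle o (ξ 0) (ξ n)
      rw [hξ] at this
      linarith
  have hseg : ∀ t : ℝ, 0 ≤ t → ∀ u ∈ Set.Icc (0 : ℝ) 1, σ.seg (f 0) (f t) u = f (u * t) := by
    intro t ht u hu
    have h1 : Filter.Tendsto (fun n => σ.seg o (e n t) u) Filter.atTop (nhds (σ.seg o (f t) u)) :=
      ((σ.continuous_seg continuous_const continuous_id continuous_const).tendsto (f t)).comp
        (hf t ht)
    rw [hf0]
    refine tendsto_nhds_unique h1 ((hf (u * t) (mul_nonneg hu.1 ht)).congr' ?_)
    filter_upwards [ev t] with n hn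
    exact (nest n t u ht hn hu).symm
  refine ⟨ofReal σ f hdist hseg, hf0, fun t => ?_⟩
  refine le_of_tendsto ((hf t t.2).dist tendsto_const_nhds) ?_
  filter_upwards [ev t] with n hn
  exact near n t (by exact_mod_cast hn)

end Ray

end Bicombing

/-! ### Discrete maximum principles -/

section RealSequences

/-- By convexity the slopes `f k / k` increase once `f 0 ≤ 0`, so the sign propagates down from `n`.
-/
theorem nonpos_of_midpoint_convex {f : ℕ → ℝ} {n : ℕ} (h0 : f 0 ≤ 0) (hn : f n ≤ 0)
    (hf : ∀ k, k + 2 ≤ n → f (k + 1) ≤ (f k + f (k + 2)) / 2) {k : ℕ} (hk : k ≤ n) : f k ≤ 0 := by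
  have key : ∀ k, k + 1 ≤ n → (k + 1 : ℝ) * f k ≤ k * f (k + 1) := by
    intro k
    induction k with
    | zero => intro _; simpa using h0
    | succ k ih =>
      intro hk
      have h1 := ih (by omega)
      have h2 := hf k (by omega)
      push_cast
      have h3 : (0 : ℝ) ≤ k + 1 := by positivity
      nlinarith
  induction hk using Nat.decreasingInduction with
  | self => exact hn
  | of_succ k hk ih =>
    have h1 := key k (by omega)
    have h2 : (k : ℝ) * f (k + 1) ≤ 0 := mul_nonpos_of_nonneg_of_nonpos (by positivity) ih
    have h3 : (0 : ℝ) < k + 1 := by positivity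
    by_contra! h
    nlinarith [mul_pos h3 h]

theorem nonpos_of_le_mul_average {f : ℤ → ℝ} {r B : ℝ} (hr0 : 0 ≤ r) (hr1 : r < 1)
    (hB : ∀ k, f k ≤ B) (hf : ∀ k, f k ≤ r * ((f (k + 1) + f (k - 1)) / 2)) (k : ℤ) :
    f k ≤ 0 := by
  have key : ∀ n : ℕ, ∀ k, f k ≤ r ^ n * B := by
    intro n
    induction n with
    | zero => simpa using hB
    | succ n ih =>
      intro k
      refine (hf k).trans ?_
      rw [pow_succ', mul_assoc]
      exact mul_le_mul_of_nonneg_left (by linarith [ih (k + 1), ih (k - 1)]) hr0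
  have h := (tendsto_pow_atTop_nhds_zero_of_lt_one hr0 hr1).mul_const B
  rw [zero_mul] at h
  exact ge_of_tendsto' h fun n => key n k

/-- `f 0` is at most the expected payoff `l * |k|` of a simple random walk from `0` that stops with
probability `1 - r` before each step. Replacing `l * x` by its majorant `a * x ^ 2 + l ^ 2 / (4 *
a)` makes this expectation explicit; for the best `a` it is of order `l / √(1 - r)`. -/
theorem le_of_le_resolvent {f : ℤ → ℝ} {r A l a : ℝ} (hr0 : 0 ≤ r) (hr1 : r < 1) (ha : 0 < a)
    (hA : ∀ k : ℤ, f k ≤ A + l * |(k : ℝ)|)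
    (hf : ∀ k : ℤ, f k ≤ (1 - r) * (l * |(k : ℝ)|) + r * ((f (k + 1) + f (k - 1)) / 2)) :
    f 0 ≤ l ^ 2 / (4 * a) + r * a / (1 - r) := by
  set b := l ^ 2 / (4 * a) + r * a / (1 - r) with hb
  have hlin : ∀ x : ℝ, l * x ≤ a * x ^ 2 + l ^ 2 / (4 * a) := by
    intro x
    have h1 : l ^ 2 / (4 * a) * (4 * a) = l ^ 2 := div_mul_cancel₀ _ (by positivity)
    by_contra! h
    nlinarith [sq_nonneg (2 * a * x - l), mul_pos (by positivity : (0 : ℝ) < 4 * a) (sub_pos.2 h)]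
  have hr : 0 < 1 - r := by linarith
  have hbr : (1 - r) * b = (1 - r) * (l ^ 2 / (4 * a)) + r * a := by
    rw [hb, mul_add, mul_div_cancel₀ _ hr.ne']
  have := nonpos_of_le_mul_average (f := fun k => f k - a * (k : ℝ) ^ 2 - b)
    (B := A + l ^ 2 / (4 * a) - b) hr0 hr1 ?_ ?_ 0
  · simpa using this
  · intro k
    have := hlin |(k : ℝ)|
    rw [sq_abs] at this
    linarith [hA k]
  · intro k
    have h1 := hlin |(k : ℝ)|
    rw [sq_abs] at h1
    have h2 := mul_le_mul_of_nonneg_left h1 hr.le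
    push_cast
    nlinarith [hf k]

end RealSequences

/-! ### Axes of elements of infinite order -/

namespace Bicombing

variable {X : Type*} [MetricSpace X]

/-- A unit speed `σ`-geodesic line. -/
structure IsLine (σ : Bicombing X) (c : ℝ → X) : Prop where
  dist_eq : ∀ s t, dist (c s) (c t) = |s - t|
  seg_eq : ∀ a b, a ≤ b → ∀ u ∈ Set.Icc (0 : ℝ) 1, σ.seg (c a) (c b) u = c (a + u * (b - a))

variable {G : Type*} [Group G] [MulAction G X] {σ : Bicombing X}

/-- The midpoint of the `σ`-geodesic from `g⁻¹ y` to `g y`. -/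
noncomputable def mid (σ : Bicombing X) (g : G) (y : X) : X := σ.seg (g⁻¹ • y) (g • y) (1 / 2)

theorem half_mem_Icc : (1 / 2 : ℝ) ∈ Set.Icc (0 : ℝ) 1 := by norm_num

theorem IsEquivariant.smul_mid (heq : σ.IsEquivariant G) (g h : G) (y : X) :
    h • σ.mid g y = σ.mid (h * g * h⁻¹) (h • y) := by
  simp only [mid, heq.smul_seg, smul_smul, mul_inv_rev, inv_inv]
  simp [mul_assoc]

/-- Local geodesics are geodesics: as each orbit point is the midpoint of its neighbours, the
distance from the `σ`-geodesic to the orbit is midpoint convex in `k`, and it vanishes at both ends.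
-/
theorem seg_orbit (hσ : σ.IsCCC) (heq : σ.IsEquivariant G) {g : G} {y : X} (hy : σ.mid g y = y)
    (j : ℤ) {n k : ℕ} (hn : 0 < n) (hk : k ≤ n) :
    σ.seg (g ^ j • y) (g ^ (j + n) • y) (k / n) = g ^ (j + k) • y := by
  have hn' : (0 : ℝ) < n := by exact_mod_cast hn
  rw [← dist_le_zero]
  refine nonpos_of_midpoint_convex (n := n)
    (f := fun k : ℕ => dist (σ.seg (g ^ j • y) (g ^ (j + n) • y) (k / n)) (g ^ (j + k) • y))
    (by simp) (by simp [div_self hn'.ne']) (fun k hk => ?_) hk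
  have h1 : σ.seg (g ^ (j + k) • y) (g ^ (j + (k + 2 : ℕ)) • y) (1 / 2) =
      g ^ (j + (k + 1 : ℕ)) • y := by
    conv_rhs => rw [← hy, mid, heq.smul_seg, smul_smul, smul_smul]
    congr 3
    · rw [← zpow_sub_one]; congr 1; push_cast; ring
    · rw [← zpow_add_one]; congr 1; push_cast; ring
  have hk' : (k : ℝ) + 2 ≤ n := by exact_mod_cast hk
  have h2 := hσ.1.seg_seg (g ^ j • y) (g ^ (j + n) • y) (a := k / n) (b := (k + 2 : ℕ) / n)
    (by positivity) (by gcongr; simp) (div_le_one_of_le₀ (by push_cast; exact hk') hn'.le)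
    half_mem_Icc
  rw [show (k : ℝ) / n + 1 / 2 * ((k + 2 : ℕ) / n - k / n) = (k + 1 : ℕ) / n by
    push_cast; ring] at h2
  rw [← h1, ← h2]
  refine (hσ.2.dist_seg_le _ _ _ _ half_mem_Icc).trans (le_of_eq ?_)
  ring

/-- A fixed point of the midpoint map lies on a `σ`-line through its orbit. -/
theorem exists_isLine_of_mid_eq_self (hσ : σ.IsCCC) (heq : σ.IsEquivariant G) {g : G} {y : X}
    (hy : σ.mid g y = y) (hgy : g • y ≠ y) :
    ∃ (c : ℝ → X) (l : ℝ), 0 < l ∧ σ.IsLine c ∧ ∀ k : ℤ, c (k * l) = g ^ k • c 0 := by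
  -- The geodesic from `g ^ (-n) • y` to `g ^ n • y`, parametrized by `[-n, n]` so that it passes
  -- through `g ^ k • y` at time `k`. These geodesics extend one another and exhaust the line.
  let P : ℕ → ℝ → X := fun n t => σ.seg (g ^ (-n : ℤ) • y) (g ^ (n : ℤ) • y) ((t + n) / (2 * n))
  have mem : ∀ {n : ℕ} {t : ℝ}, 0 < n → |t| ≤ n → (t + n) / (2 * n) ∈ Set.Icc (0 : ℝ) 1 := by
    intro n t hn ht
    have hn' : (0 : ℝ) < n := by exact_mod_cast hn
    rw [abs_le] at ht
    exact ⟨div_nonneg (by linarith) (by linarith), div_le_one_of_le₀ (by linarith) (by linarith)⟩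
  have Pint : ∀ (n : ℕ) (k : ℤ), 0 < n → |k| ≤ n → P n k = g ^ k • y := by
    intro n k hn hk
    rw [abs_le] at hk
    obtain ⟨i, hi⟩ := Int.eq_ofNat_of_zero_le (show 0 ≤ k + n by linarith)
    have h := seg_orbit hσ heq hy (-n) (n := 2 * n) (k := i) (by omega) (by omega)
    rw [show (-n + (2 * n : ℕ) : ℤ) = n by push_cast; ring, show (-n + i : ℤ) = k by omega] at h
    rw [← h]
    simp only [P]
    congr 1
    rw [show (i : ℝ) = k + n by exact_mod_cast hi.symm]; push_cast; rfl
  have Pseg : ∀ (n : ℕ) (a b u : ℝ), 0 < n → |a| ≤ n → |b| ≤ n → a ≤ b →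
      u ∈ Set.Icc (0 : ℝ) 1 → σ.seg (P n a) (P n b) u = P n (a + u * (b - a)) := by
    intro n a b u hn ha hb hab hu
    have hn' : (0 : ℝ) < n := by exact_mod_cast hn
    have h := hσ.1.seg_seg (g ^ (-n : ℤ) • y) (g ^ (n : ℤ) • y) (mem hn ha).1
      (by gcongr) (mem hn hb).2 hu
    simp only [P]
    rw [h]; congr 1; field_simp; ring
  have Pmono : ∀ (n m : ℕ) (t : ℝ), 0 < n → n ≤ m → |t| ≤ n → P n t = P m t := by
    intro n m t hn hnm ht
    have hn' : (0 : ℝ) < n := by exact_mod_cast hn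
    have hnm' : (n : ℝ) ≤ m := by exact_mod_cast hnm
    have h1 := Pint m (-n) (by omega) (by simpa using hnm)
    have h2 := Pint m n (by omega) (by simpa using hnm)
    have h := Pseg m (-n) n ((t + n) / (2 * n)) (by omega) (by simpa using hnm')
      (by simpa using hnm') (by linarith) (mem hn ht)
    push_cast at h1 h2
    rw [h1, h2] at h
    simp only [P] at h ⊢
    rw [h]; congr 1; field_simp; ring
  let c : ℝ → X := fun t => P (⌈|t|⌉₊ + 1) t
  have cP : ∀ (n : ℕ) (t : ℝ), 0 < n → |t| ≤ n → c t = P n t := by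
    intro n t hn ht
    refine (Pmono _ (max n (⌈|t|⌉₊ + 1)) t (by omega) (le_max_right _ _) ?_).trans
      (Pmono _ _ t hn (le_max_left _ _) ht).symm
    push_cast
    linarith [Nat.le_ceil |t|]
  have big : ∀ a b : ℝ, ∃ n : ℕ, 0 < n ∧ |a| ≤ n ∧ |b| ≤ n := by
    intro a b
    obtain ⟨n, hn⟩ := exists_nat_gt (max |a| |b|)
    have h1 := (le_max_left _ _).trans_lt hn
    have h2 := (le_max_right _ _).trans_lt hn
    exact ⟨n, by exact_mod_cast (abs_nonneg a).trans_lt h1, h1.le, h2.le⟩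
  have cint : ∀ k : ℤ, c k = g ^ k • y := by
    intro k
    obtain ⟨n, hn, h1, -⟩ := big k k
    rw [cP n k hn h1, Pint n k hn (by exact_mod_cast h1)]
  have cseg : ∀ a b, a ≤ b → ∀ u ∈ Set.Icc (0 : ℝ) 1,
      σ.seg (c a) (c b) u = c (a + u * (b - a)) := by
    intro a b hab u hu
    obtain ⟨n, hn, ha, hb⟩ := big a b
    rw [cP n a hn ha, cP n b hn hb, Pseg n a b u hn ha hb hab hu, cP n _ hn]
    rw [abs_le] at ha hb ⊢
    constructor <;> nlinarith [hu.1, hu.2]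
  have cdist : ∀ a b, dist (c a) (c b) = |a - b| * dist y (g • y) := by
    have h0 : ∀ (n : ℕ) (a b : ℝ), 0 < n → |a| ≤ n → |b| ≤ n → dist (c a) (c b) =
        |a - b| * (dist (g ^ (-n : ℤ) • y) (g ^ (n : ℤ) • y) / (2 * n)) := by
      intro n a b hn ha hb
      have hn' : (0 : ℝ) < n := by exact_mod_cast hn
      rw [cP n a hn ha, cP n b hn hb]
      simp only [P]
      rw [σ.dist_seg_seg _ _ (mem hn ha) (mem hn hb), ← sub_div, abs_div,
        abs_of_pos (show (0 : ℝ) < 2 * n by positivity), add_sub_add_right_eq_sub]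
      ring
    intro a b
    obtain ⟨n, hn, ha, hb⟩ := big a b
    have hn1 : (1 : ℝ) ≤ n := by exact_mod_cast hn
    have h1 := h0 n 0 1 hn (by simp) (by simpa using hn1)
    rw [h0 n a b hn ha hb]
    have h2 := cint 0
    have h3 := cint 1
    simp only [Int.cast_zero, Int.cast_one, zpow_zero, zpow_one, one_smul] at h2 h3
    rw [h2, h3, zero_sub, abs_neg, abs_one, one_mul] at h1
    rw [h1]
  set l := dist y (g • y) with hl
  have hl0 : 0 < l := dist_pos.2 hgy.symm
  refine ⟨fun t => c (t / l), l, hl0, ⟨fun s t => ?_, fun a b hab u hu => ?_⟩, fun k => ?_⟩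
  · rw [cdist, ← sub_div, abs_div, abs_of_pos hl0, div_mul_cancel₀ _ hl0.ne']
  · rw [cseg _ _ (by gcongr) u hu]; congr 1; ring
  · have h2 := cint 0
    simp only [Int.cast_zero, zpow_zero, one_smul] at h2
    simp only [zero_div]
    rw [mul_div_cancel_right₀ _ hl0.ne', cint, h2]

variable [IsIsometricSMul G X]

theorem continuous_mid (g : G) : Continuous (σ.mid g) :=
  σ.continuous_seg (isometry_smul X g⁻¹).continuous (isometry_smul X g).continuous continuous_const

theorem IsConical.dist_mid_mid_le (hσ : σ.IsConical) (g : G) (x y : X) :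
    dist (σ.mid g x) (σ.mid g y) ≤ dist x y := by
  refine (hσ.dist_seg_le _ _ _ _ half_mem_Icc).trans ?_
  rw [dist_smul, dist_smul]; linarith

theorem IsConical.dist_mid_le (hσ : σ.IsConical) (g : G) (x w : X) :
    dist (σ.mid g x) w ≤ (dist x (g • w) + dist x (g⁻¹ • w)) / 2 := by
  have h := hσ.dist_seg_le (g⁻¹ • x) (g • x) w w half_mem_Icc
  rw [σ.seg_self w half_mem_Icc] at h
  rw [← dist_smul g⁻¹ x (g • w), ← dist_smul g x (g⁻¹ • w), inv_smul_smul, smul_inv_smul]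
  refine h.trans (le_of_eq ?_)
  ring

theorem dist_zpow_smul_le (g : G) (o : X) (k : ℤ) :
    dist o (g ^ k • o) ≤ dist o (g • o) * |(k : ℝ)| := by
  have hnat : ∀ n : ℕ, dist o (g ^ n • o) ≤ dist o (g • o) * n := by
    intro n
    induction n with
    | zero => simp
    | succ n ih =>
      refine (dist_triangle _ (g ^ n • o) _).trans ?_
      rw [pow_succ, mul_smul, dist_smul]; push_cast; linarith
  rcases k.eq_nat_or_neg with ⟨n, rfl | rfl⟩
  · simpa using hnat n
  · rw [zpow_neg, ← dist_smul (g ^ (n : ℤ)), smul_inv_smul, dist_comm]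
    simpa using hnat n

/-- An isometry of a space with a conical bicombing almost fixes the midpoint map of its orbits. -/
theorem exists_dist_mid_le [CompleteSpace X] (hσ : σ.IsConical) (heq : σ.IsEquivariant G) (g : G)
    (o : X) {ε : ℝ} (hε : 0 < ε) :
    ∃ y, dist y (g • y) ≤ dist o (g • o) ∧ dist y (σ.mid g y) ≤ ε := by
  set l := dist o (g • o) with hl
  have hl0 : 0 ≤ l := dist_nonneg
  -- `p = 1 - r` is the stopping probability. The estimate `le_of_le_resolvent` with `a = ε / 2`
  -- leaves the error `p * (l ^ 2 / (2 * ε) + l) + r * (ε / 2)`.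
  obtain ⟨p, hp0, hp1, hp⟩ : ∃ p : ℝ, 0 < p ∧ p ≤ 1 / 2 ∧ p * (l ^ 2 / (2 * ε) + l) ≤ ε / 2 := by
    have hq : 0 < l ^ 2 / (2 * ε) + l + 1 := by positivity
    refine ⟨min (1 / 2) (ε / 2 / (l ^ 2 / (2 * ε) + l + 1)), by positivity, min_le_left _ _, ?_⟩
    calc _ ≤ (ε / 2 / (l ^ 2 / (2 * ε) + l + 1)) * (l ^ 2 / (2 * ε) + l) :=
          mul_le_mul_of_nonneg_right (min_le_right _ _) (by positivity)
      _ ≤ (ε / 2 / (l ^ 2 / (2 * ε) + l + 1)) * (l ^ 2 / (2 * ε) + l + 1) :=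
          mul_le_mul_of_nonneg_left (by linarith) (by positivity)
      _ = ε / 2 := div_mul_cancel₀ _ hq.ne'
  set r : ℝ := 1 - p with hr
  have hr0 : 0 ≤ r := by linarith
  have hr1 : r < 1 := by linarith
  have hrm : r ∈ Set.Icc (0 : ℝ) 1 := ⟨hr0, hr1.le⟩
  have hcontr : ContractingWith ⟨r, hr0⟩ fun y => σ.seg o (σ.mid g y) r := by
    refine ⟨NNReal.coe_lt_coe.1 hr1, LipschitzWith.of_dist_le_mul fun x y => ?_⟩
    refine (hσ.dist_seg_le _ _ _ _ hrm).trans ?_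
    rw [dist_self, mul_zero, zero_add]
    exact mul_le_mul_of_nonneg_left (hσ.dist_mid_mid_le g x y) hr0
  have : Nonempty X := ⟨o⟩
  set y := hcontr.fixedPoint with hydef
  have hy : σ.seg o (σ.mid g y) r = y := hcontr.fixedPoint_isFixedPt
  clear_value y
  -- `g • y` is the fixed point of the same contraction with `g • o` in place of `o`, so it is no
  -- farther from `y` than `g • o` is from `o`.
  have hdisp : dist y (g • y) ≤ l := by
    have h1 : g • y = σ.seg (g • o) (σ.mid g (g • y)) r := by
      conv_lhs => rw [← hy]
      rw [heq.smul_seg, heq.smul_mid, mul_inv_cancel_right]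
    have h2 := hσ.dist_seg_le o (σ.mid g y) (g • o) (σ.mid g (g • y)) hrm
    rw [hy, ← h1] at h2
    have h3 := mul_le_mul_of_nonneg_left (hσ.dist_mid_mid_le g y (g • y)) hr0
    have h4 : p * dist y (g • y) ≤ p * l := by
      rw [hr] at h2 h3; linarith
    exact le_of_mul_le_mul_left h4 hp0
  refine ⟨y, hdisp, ?_⟩
  -- The crude bound `dist o (σ.mid g y) ≤ dist y o + l` is useful only if `dist y o` grows more
  -- slowly than `1 / p`; the random walk estimate along the orbit of `o` supplies this.
  have hF := le_of_le_resolvent (f := fun k : ℤ => dist y (g ^ k • o)) (r := r) (A := dist y o)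
    (l := l) (a := ε / 2) hr0 hr1 (by positivity) (fun k => ?_) (fun k => ?_)
  · have h1 : dist y (σ.mid g y) = p * dist o (σ.mid g y) := by
      have := σ.dist_seg_right o (σ.mid g y) hrm
      rwa [hy, hr, sub_sub_cancel] at this
    have h2 := hσ.dist_mid_le g y o
    have h3 : dist y (g • o) ≤ dist y o + l := dist_triangle _ _ _
    have h4 : dist y (g⁻¹ • o) ≤ dist y o + l := by
      refine (dist_triangle _ o _).trans ?_
      rw [← dist_smul g o, smul_inv_smul, dist_comm (g • o)]
    rw [dist_comm] at h2
    have h5 : dist o (σ.mid g y) ≤ dist y o + l := by linarith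
    simp only [zpow_zero, one_smul] at hF
    rw [h1]
    have h6 : p * (r * (ε / 2) / (1 - r)) = r * (ε / 2) := by
      rw [hr, sub_sub_cancel, mul_div_cancel₀ _ hp0.ne']
    have h7 : l ^ 2 / (4 * (ε / 2)) = l ^ 2 / (2 * ε) := by ring
    rw [h7] at hF
    calc p * dist o (σ.mid g y) ≤ p * (dist y o + l) := mul_le_mul_of_nonneg_left h5 hp0.le
      _ ≤ p * (l ^ 2 / (2 * ε) + r * (ε / 2) / (1 - r) + l) :=
        mul_le_mul_of_nonneg_left (by linarith) hp0.le
      _ = p * (l ^ 2 / (2 * ε) + l) + p * (r * (ε / 2) / (1 - r)) := by ring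
      _ = p * (l ^ 2 / (2 * ε) + l) + r * (ε / 2) := by rw [h6]
      _ ≤ ε := by nlinarith
  · refine (dist_triangle _ o _).trans ?_
    linarith [dist_zpow_smul_le g o k]
  · have h1 := hσ.dist_seg_le o (σ.mid g y) (g ^ k • o) (g ^ k • o) hrm
    rw [hy, σ.seg_self _ hrm] at h1
    refine h1.trans (add_le_add ?_ ?_)
    · exact mul_le_mul_of_nonneg_left (dist_zpow_smul_le g o k) (by linarith)
    · refine mul_le_mul_of_nonneg_left ?_ hr0
      refine (hσ.dist_mid_le g y _).trans (le_of_eq ?_)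
      rw [smul_smul, smul_smul, mul_self_zpow, ← zpow_neg_one, ← zpow_add,
        neg_add_eq_sub]

/-- Approximate fixed points are moved into a ball around `o`, replacing `g` by conjugates of
bounded displacement at `o`. There are finitely many of these, so one serves all `ε`; compactness of
the ball yields its fixed point, which is moved back. -/
theorem exists_mid_eq_self [ProperSpace X] (hσ : σ.IsConical) (heq : σ.IsEquivariant G) (o : X)
    {D : ℝ} (hD : ∀ x : X, ∃ g : G, dist x (g • o) ≤ D)
    (hprop : ∀ R : ℝ, {g : G | dist o (g • o) ≤ R}.Finite) (g : G) :
    ∃ y, σ.mid g y = y := by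
  set l := dist o (g • o) with hl
  set S := {h : G | dist o (h • o) ≤ 2 * D + l} with hS
  have hSfin : S.Finite := hprop _
  have key : ∀ ε : ℝ, 0 < ε → ∃ h ∈ S, (∃ k, h = k⁻¹ * g * k) ∧
      ∃ x ∈ Metric.closedBall o D, dist x (σ.mid h x) ≤ ε := by
    intro ε hε
    obtain ⟨y, hy1, hy2⟩ := exists_dist_mid_le hσ heq g o hε
    obtain ⟨k, hk⟩ := hD y
    have hx : dist (k⁻¹ • y) o ≤ D := by rwa [← dist_smul k, smul_inv_smul]
    refine ⟨k⁻¹ * g * k, ?_, ⟨k, rfl⟩, k⁻¹ • y, hx, ?_⟩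
    · have h1 : dist (k⁻¹ • y) ((k⁻¹ * g * k) • k⁻¹ • y) ≤ l := by
        rw [smul_smul, mul_assoc, mul_inv_cancel, mul_one, mul_smul, dist_smul]; exact hy1
      have h2 : dist ((k⁻¹ * g * k) • k⁻¹ • y) ((k⁻¹ * g * k) • o) ≤ D := by rwa [dist_smul]
      have h3 := dist_triangle4 o (k⁻¹ • y) ((k⁻¹ * g * k) • k⁻¹ • y) ((k⁻¹ * g * k) • o)
      rw [dist_comm o (k⁻¹ • y)] at h3
      change dist o _ ≤ _
      linarith
    · have := heq.smul_mid g k⁻¹ y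
      rw [inv_inv] at this
      rw [← this, dist_smul]; exact hy2
  obtain ⟨h, -, ⟨k, hk⟩, hh⟩ : ∃ h ∈ S, (∃ k, h = k⁻¹ * g * k) ∧ ∀ ε : ℝ, 0 < ε →
      ∃ x ∈ Metric.closedBall o D, dist x (σ.mid h x) ≤ ε := by
    -- Otherwise each of the finitely many conjugates fails below some threshold `e h`, and `key` at
    -- the least threshold is violated.
    by_contra! hcon
    have : ∀ h, ∃ ε : ℝ, 0 < ε ∧ (h ∈ S → (∃ k, h = k⁻¹ * g * k) →
        ∀ x ∈ Metric.closedBall o D, ε < dist x (σ.mid h x)) := by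
      intro h
      by_cases hh : h ∈ S ∧ ∃ k, h = k⁻¹ * g * k
      · obtain ⟨ε, hε, h'⟩ := hcon h hh.1 hh.2
        exact ⟨ε, hε, fun _ _ => h'⟩
      · exact ⟨1, one_pos, fun h1 h2 => absurd ⟨h1, h2⟩ hh⟩
    choose e he0 he using this
    obtain ⟨h0, hh0, -⟩ := key 1 one_pos
    obtain ⟨m, hm, hmin⟩ := hSfin.exists_minimalFor e S ⟨h0, hh0⟩
    obtain ⟨h, hh, hk, x, hx, hxe⟩ := key (e m) (he0 m)
    have h1 := he h hh hk x hx
    have h2 : e m ≤ e h := by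
      rcases le_total (e m) (e h) with h3 | h3
      · exact h3
      · exact hmin hh h3
    linarith
  obtain ⟨x0, hx0, -⟩ := hh 1 one_pos
  have hcont : Continuous fun x => dist x (σ.mid h x) := continuous_id.dist (continuous_mid h)
  obtain ⟨x, hx, hmin⟩ :=
    (isCompact_closedBall o D).exists_isMinOn ⟨x0, hx0⟩ hcont.continuousOn
  have hzero : dist x (σ.mid h x) = 0 := by
    refine le_antisymm (le_of_forall_pos_le_add fun ε hε => ?_) dist_nonneg
    obtain ⟨x', hx', h'⟩ := hh ε hε
    have := hmin hx'
    exact (show dist x _ ≤ dist x' _ from this).trans (by linarith)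
  refine ⟨k • x, ?_⟩
  have h1 := heq.smul_mid h k x
  rw [← dist_eq_zero.1 hzero, hk] at h1
  rw [show g = k * (k⁻¹ * g * k) * k⁻¹ by group, ← h1]

/-- An element of infinite order of a group that acts geometrically has a `σ`-axis. -/
theorem exists_axis [ProperSpace X] (hσ : σ.IsCCC) (heq : σ.IsEquivariant G) (o : X)
    {D : ℝ} (hD : ∀ x : X, ∃ g : G, dist x (g • o) ≤ D)
    (hprop : ∀ R : ℝ, {g : G | dist o (g • o) ≤ R}.Finite) {g : G} (hg : ¬ IsOfFinOrder g) :
    ∃ (c : ℝ → X) (l : ℝ), 0 < l ∧ σ.IsLine c ∧ ∀ k : ℤ, c (k * l) = g ^ k • c 0 := by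
  obtain ⟨y, hy⟩ := exists_mid_eq_self hσ.2 heq o hD hprop g
  refine exists_isLine_of_mid_eq_self hσ heq hy fun hgy => ?_
  have hpow : ∀ n : ℕ, g ^ n • y = y := by
    intro n
    induction n with
    | zero => simp
    | succ n ih => rw [pow_succ, mul_smul, hgy, ih]
  have hsub : Set.range (fun n : ℕ => g ^ n) ⊆ {h : G | dist o (h • o) ≤ 2 * dist o y} := by
    rintro _ ⟨n, rfl⟩
    have h1 := dist_triangle o y (g ^ n • o)
    have h2 : dist y (g ^ n • o) = dist o y := by
      conv_lhs => rw [← hpow n]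
      rw [dist_smul, dist_comm]
    change dist o _ ≤ _
    linarith
  exact Set.infinite_range_of_injective (injective_pow_iff_not_isOfFinOrder.2 hg)
    ((hprop _).subset hsub)

end Bicombing

/-! ### The almost invariant set of an amalgam -/

section Amalgam

open Monoid

variable {G : Type*} [Group G] {A : Fin 2 → Subgroup G} {Z : Subgroup G} (h : ∀ i, Z ≤ A i)

theorem amalgamMap_of {i : Fin 2} (a : A i) :
    amalgamMap A Z h (PushoutI.of (φ := fun i => Subgroup.inclusion (h i)) i a) = a := by
  unfold amalgamMap
  exact PushoutI.lift_of (fun i => (A i).subtype) Z.subtype (fun _ => rfl) a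

theorem amalgamMap_base (z : Z) :
    amalgamMap A Z h (PushoutI.base (fun i => Subgroup.inclusion (h i)) z) = z := by
  unfold amalgamMap
  exact PushoutI.lift_base (fun i => (A i).subtype) Z.subtype (fun _ => rfl) z

/-- `g` is represented by a reduced word whose first letter lies in `A i`. -/
def StartsIn (i : Fin 2) (g : G) : Prop :=
  ∃ w : CoprodI.Word fun i => A i, PushoutI.Reduced (fun i => Subgroup.inclusion (h i)) w ∧
    w.fstIdx = some i ∧ amalgamMap A Z h (PushoutI.ofCoprodI w.prod) = g

variable {h}

/-- By the normal form theorem a reduced word representing an element of `Z` is empty, so it has no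
first letter. -/
theorem StartsIn.notMem (hinj : Function.Injective (amalgamMap A Z h)) {i : Fin 2} {g : G}
    (hg : StartsIn h i g) : g ∉ Z := by
  obtain ⟨w, hw, hi, rfl⟩ := hg
  intro hz
  have hw0 := hw.eq_empty_of_mem_range (fun i => Subgroup.inclusion_injective (h i))
    ⟨⟨_, hz⟩, hinj (by rw [amalgamMap_base])⟩
  rw [hw0] at hi
  simp [CoprodI.Word.fstIdx, CoprodI.Word.empty] at hi

theorem notMem_range_inclusion {i : Fin 2} {a : G} (ha : a ∈ A i) (haZ : a ∉ Z) :
    (⟨a, ha⟩ : A i) ∉ (Subgroup.inclusion (h i)).range := by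
  rintro ⟨z, hz⟩
  apply haZ
  have := congrArg Subtype.val hz
  simp only [Subgroup.coe_inclusion] at this
  rw [← this]; exact z.2

theorem StartsIn.cons_word {i : Fin 2} {a : G} (ha : a ∈ A i) (haZ : a ∉ Z)
    {w : CoprodI.Word fun i => A i}
    (hw : PushoutI.Reduced (fun i => Subgroup.inclusion (h i)) w) (hi : w.fstIdx ≠ some i) :
    StartsIn h i (a * amalgamMap A Z h (PushoutI.ofCoprodI w.prod)) := by
  have ha1 : (⟨a, ha⟩ : A i) ≠ 1 := fun h1 => haZ (by
    rw [show a = 1 from congrArg Subtype.val h1]; exact Z.one_mem)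
  refine ⟨CoprodI.Word.cons ⟨a, ha⟩ w hi ha1, ?_, ?_, ?_⟩
  · intro g hg
    rcases List.mem_cons.1 hg with rfl | hg
    · exact notMem_range_inclusion ha haZ
    · exact hw g hg
  · simp
  · rw [CoprodI.Word.prod_cons, map_mul, map_mul, PushoutI.ofCoprodI_of, amalgamMap_of]

theorem StartsIn.of_mem {i : Fin 2} {a : G} (ha : a ∈ A i) (haZ : a ∉ Z) : StartsIn h i a := by
  have := StartsIn.cons_word (h := h) ha haZ (w := CoprodI.Word.empty)
    (by intro g hg; simp [CoprodI.Word.empty] at hg)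
    (by simp [CoprodI.Word.fstIdx, CoprodI.Word.empty])
  simpa using this

theorem StartsIn.mul {i j : Fin 2} (hij : i ≠ j) {a g : G} (ha : a ∈ A i) (haZ : a ∉ Z)
    (hg : StartsIn h j g) : StartsIn h i (a * g) := by
  obtain ⟨w, hw, hj, rfl⟩ := hg
  exact StartsIn.cons_word ha haZ hw (by rw [hj]; simpa using hij.symm)

theorem StartsIn.pow_mul {i j : Fin 2} (hij : i ≠ j) {a b : G} (ha : a ∈ A i) (haZ : a ∉ Z)
    (hb : b ∈ A j) (hbZ : b ∉ Z) (n : ℕ) : StartsIn h i ((a * b) ^ n * a) := by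
  induction n with
  | zero => simpa using StartsIn.of_mem ha haZ
  | succ n ih =>
    rw [pow_succ', mul_assoc, mul_assoc]
    exact .mul hij ha haZ (.mul hij.symm hb hbZ ih)

theorem StartsIn.pow_succ {i j : Fin 2} (hij : i ≠ j) {a b : G} (ha : a ∈ A i) (haZ : a ∉ Z)
    (hb : b ∈ A j) (hbZ : b ∉ Z) (n : ℕ) : StartsIn h i ((a * b) ^ (n + 1)) := by
  rw [_root_.pow_succ, ← mul_assoc, mul_pow_mul, mul_assoc]
  exact .mul hij ha haZ (.pow_mul hij.symm hb hbZ ha haZ n)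

theorem amalgam_induction (hsurj : Function.Surjective (amalgamMap A Z h)) {P : G → Prop}
    (hA : ∀ i, ∀ a ∈ A i, P a) (hmul : ∀ a b, P a → P b → P (a * b)) (g : G) : P g := by
  obtain ⟨x, rfl⟩ := hsurj g
  induction x using PushoutI.induction_on with
  | of i a => rw [amalgamMap_of]; exact hA i a a.2
  | base z => rw [amalgamMap_base]; exact hA 0 z (h 0 z.2)
  | mul x y hx hy => rw [map_mul]; exact hmul _ _ hx hy

/-- The action of `G` on `G × ℤ` by right translations of the first factor. -/
def rightTranslation (G : Type*) [Group G] : G →* Equiv.Perm (G × ℤ) where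
  toFun a := (Equiv.mulRight a⁻¹).prodCongr (Equiv.refl ℤ)
  map_one' := by ext <;> simp
  map_mul' a b := by ext <;> simp [mul_assoc]

/-- The shear of `G × ℤ` along the function `d : G → ℤ`. -/
def shear (d : G → ℤ) : Equiv.Perm (G × ℤ) where
  toFun p := (p.1, p.2 + d p.1)
  invFun p := (p.1, p.2 - d p.1)
  left_inv p := by simp
  right_inv p := by simp

open Classical in
/-- A function on an amalgamated product that is constant along right multiplication by the second
factor, and changes along right multiplication by the first one only at the elements of the
amalgamated subgroup. -/
theorem exists_sideFunction (hbij : Function.Bijective (amalgamMap A Z h)) :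
    ∃ χ : G → ℤ, χ 1 = 0 ∧ (∀ g, ∀ a ∈ A 1, χ (g * a) = χ g) ∧
      ∀ g, ∀ a ∈ A 0, χ (g * a) =
        χ g + (if g ∈ Z then 1 else 0) - (if g * a ∈ Z then 1 else 0) := by
  let d : G → ℤ := fun g => if g ∈ Z then 1 else 0
  let R := rightTranslation G
  -- Conjugation by the shear does not affect `Z`, because `d` is invariant under right
  -- multiplication by `Z`. So the sheared action of `A 0` and the plain one of `A 1` glue to an
  -- action of the amalgam.
  let f : ∀ i, A i →* Equiv.Perm (G × ℤ) := fun i =>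
    if i = 0 then (MulAut.conj (shear d)⁻¹).toMonoidHom.comp (R.comp (A i).subtype)
    else R.comp (A i).subtype
  have hf : ∀ i, (f i).comp (Subgroup.inclusion (h i)) = R.comp Z.subtype := by
    intro i
    ext1 z
    by_cases hi : i = 0
    · simp only [f, if_pos hi, MonoidHom.comp_apply]
      change (shear d)⁻¹ * R z * (shear d)⁻¹⁻¹ = R z
      rw [inv_inv, mul_assoc, inv_mul_eq_iff_eq_mul]
      ext p
      · rfl
      · have : d (p.1 * (z : G)⁻¹) = d p.1 := by
          simp only [d, Subgroup.mul_mem_cancel_right Z (Z.inv_mem z.2)]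
        change p.2 + d p.1 = p.2 + d (p.1 * (z : G)⁻¹)
        rw [this]
    · simp only [f, if_neg hi]; rfl
  let e := MulEquiv.ofBijective (amalgamMap A Z h) hbij
  let Φ : G →* Equiv.Perm (G × ℤ) := (PushoutI.lift f (R.comp Z.subtype) hf).comp
    e.symm.toMonoidHom
  have hΦ : ∀ i, ∀ a (ha : a ∈ A i), Φ a = f i ⟨a, ha⟩ := by
    intro i a ha
    have h1 : e.symm a = PushoutI.of i ⟨a, ha⟩ := by
      rw [MulEquiv.symm_apply_eq]; exact (amalgamMap_of h ⟨a, ha⟩).symm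
    change PushoutI.lift f _ hf (e.symm a) = _
    rw [h1, PushoutI.lift_of]
  have hΦ1 : ∀ a ∈ A 1, Φ a = R a := by
    intro a ha
    rw [hΦ 1 a ha]; simp only [f, one_ne_zero, if_false]; rfl
  have hΦ0 : ∀ a ∈ A 0, Φ a = (shear d)⁻¹ * R a * shear d := by
    intro a ha
    rw [hΦ 0 a ha]; simp only [f, if_true]
    change (shear d)⁻¹ * R a * (shear d)⁻¹⁻¹ = _
    rw [inv_inv]
  have hfst : ∀ k, ∀ p, (Φ k p).1 = p.1 * k⁻¹ := by
    refine amalgam_induction hbij.2 (fun i a ha p => ?_) (fun a b ha hb p => ?_)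
    · fin_cases i
      · rw [hΦ0 a ha]; rfl
      · rw [hΦ1 a ha]; rfl
    · rw [map_mul, Equiv.Perm.mul_apply, ha, hb, mul_inv_rev, mul_assoc]
  have hstep : ∀ g a, (Φ (g * a)⁻¹ (1, 0)) = Φ a⁻¹ (g, (Φ g⁻¹ (1, 0)).2) := by
    intro g a
    rw [mul_inv_rev, map_mul, Equiv.Perm.mul_apply]
    congr 1
    ext
    · exact (hfst g⁻¹ (1, 0)).trans (by simp)
    · rfl
  -- With the inverse, passing from `g` to `g * a` applies `a⁻¹` at a point over `g`, which by
  -- `hstep` changes the height as required.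
  refine ⟨fun k => (Φ k⁻¹ (1, 0)).2, by simp, fun g a ha => ?_, fun g a ha => ?_⟩
  · dsimp only
    rw [hstep, hΦ1 _ (inv_mem ha)]; rfl
  · dsimp only
    rw [hstep, hΦ0 _ (inv_mem ha)]
    change _ + d g - d (g * a⁻¹⁻¹) = _
    rw [inv_inv]

/-- A change under `k * l` is a change under `k` at `g` or under `l` at `g * k`, so it suffices to
treat the factors. -/
theorem finite_coboundary (hsurj : Function.Surjective (amalgamMap A Z h)) {χ : G → ℤ}
    (h1 : ∀ g, ∀ a ∈ A 1, χ (g * a) = χ g)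
    (h0 : ∀ g, ∀ a ∈ A 0, g ∉ Z → g * a ∉ Z → χ (g * a) = χ g) (k : G) :
    ∃ F : Set G, F.Finite ∧ ∀ g, χ (g * k) ≠ χ g → ∃ z ∈ Z, ∃ f ∈ F, g = z * f := by
  revert k
  refine amalgam_induction hsurj (fun i a ha => ?_) ?_
  · fin_cases i
    · refine ⟨{1, a⁻¹}, by simp, fun g hg => ?_⟩
      by_contra! hcon
      refine hg (h0 g a ha (fun hz => ?_) fun hz => ?_)
      · exact hcon g hz 1 (by simp) (by simp)
      · exact hcon _ hz a⁻¹ (by simp) (by simp)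
    · exact ⟨∅, Set.finite_empty, fun g hg => absurd (h1 g a ha) hg⟩
  · rintro k l ⟨F, hF, hF'⟩ ⟨E, hE, hE'⟩
    refine ⟨F ∪ (fun e => e * k⁻¹) '' E, hF.union (hE.image _), fun g hg => ?_⟩
    by_cases hk : χ (g * k) = χ g
    · obtain ⟨z, hz, f, hf, he⟩ := hE' (g * k) (by rwa [hk, mul_assoc])
      exact ⟨z, hz, f * k⁻¹, Or.inr ⟨f, hf, rfl⟩, by rw [← mul_assoc, ← he]; simp⟩
    · obtain ⟨z, hz, f, hf, he⟩ := hF' g hk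
      exact ⟨z, hz, f, Or.inl hf, he⟩

end Amalgam

/-- An amalgamated product has a subset that is almost invariant over the amalgamated subgroup `Z`
and divides it into two parts, each of which contains the positive powers of an element no positive
power of which lies in `Z`. -/
theorem IsAmalgamatedProduct.exists_almostInvariant {G : Type*} [Group G] {G₁ G₂ Z : Subgroup G}
    (hG : IsAmalgamatedProduct G₁ G₂ Z) (h₁ : G₁ ≠ Z) (h₂ : G₂ ≠ Z) :
    ∃ U : Set G,
      (∀ k, ∃ F : Set G, F.Finite ∧
        ∀ g, ¬ (g * k ∈ U ↔ g ∈ U) → ∃ z ∈ Z, ∃ f ∈ F, g = z * f) ∧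
      (∃ g, ∀ n : ℕ, g ^ (n + 1) ∉ Z ∧ g ^ (n + 1) ∈ U) ∧
      ∃ g, ∀ n : ℕ, g ^ (n + 1) ∉ Z ∧ g ^ (n + 1) ∈ Uᶜ := by
  obtain ⟨h, hbij⟩ := hG
  obtain ⟨a, ha, haZ⟩ := SetLike.exists_of_lt (lt_of_le_of_ne (h 0) h₁.symm)
  obtain ⟨b, hb, hbZ⟩ := SetLike.exists_of_lt (lt_of_le_of_ne (h 1) h₂.symm)
  have ha' : a ∈ ![G₁, G₂] 0 := ha
  have hb' : b ∈ ![G₁, G₂] 1 := hb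
  obtain ⟨χ, χ1, hχ1, hχ0⟩ := exists_sideFunction hbij
  have hab : ∀ n, (a * b) ^ (n + 1) ∉ Z := fun n =>
    (StartsIn.pow_succ (h := h) zero_ne_one ha' haZ hb' hbZ n).notMem hbij.1
  have hba : ∀ n, (b * a) ^ (n + 1) ∉ Z := fun n =>
    (StartsIn.pow_succ (h := h) one_ne_zero hb' hbZ ha' haZ n).notMem hbij.1
  have haba : ∀ n, (a * b) ^ n * a ∉ Z := fun n =>
    (StartsIn.pow_mul (h := h) zero_ne_one ha' haZ hb' hbZ n).notMem hbij.1
  have hbab : ∀ n, (b * a) ^ n * b ∉ Z := fun n =>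
    (StartsIn.pow_mul (h := h) one_ne_zero hb' hbZ ha' haZ n).notMem hbij.1
  -- `χ` is `1` on reduced words that begin in `G₁ \ Z` and `0` elsewhere; only its values on powers
  -- of `a * b` and `b * a` are needed.
  refine ⟨{g | χ g ≠ 0}, fun k => ?_, ⟨a * b, fun n => ⟨hab n, ?_⟩⟩, ⟨b * a, fun n => ⟨hba n, ?_⟩⟩⟩
  · obtain ⟨F, hF, hF'⟩ := finite_coboundary hbij.2 hχ1
      (fun g a ha hg hga => by rw [hχ0 g a ha, if_neg hg, if_neg hga]; simp) k
    refine ⟨F, hF, fun g hg => hF' g fun he => hg ?_⟩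
    change χ (g * k) ≠ 0 ↔ χ g ≠ 0
    rw [he]
  · have : ∀ n, χ ((a * b) ^ (n + 1)) = 1 := by
      intro n
      rw [pow_succ, ← mul_assoc, hχ1 _ b hb', hχ0 _ a ha', if_neg (haba n)]
      induction n with
      | zero => simp [χ1, Z.one_mem]
      | succ n ih =>
        rw [if_neg (hab n), pow_succ, ← mul_assoc, hχ1 _ b hb', hχ0 _ a ha', if_neg (haba n), ih]
        simp
    change χ _ ≠ 0
    rw [this]; exact one_ne_zero
  · have : ∀ n, χ ((b * a) ^ n) = 0 := by
      intro n
      induction n with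
      | zero => simp [χ1]
      | succ n ih =>
        have h1 := hba n
        rw [pow_succ, ← mul_assoc] at h1 ⊢
        rw [hχ0 _ a ha', if_neg (hbab n), if_neg h1, hχ1 _ b hb', ih]; simp
    change ¬ (χ _ ≠ 0)
    rw [this]; simp

/-! ### Finiteness from virtual cyclicity and geometric actions -/

theorem IsVirtuallyInt.exists_zpow_mul {G : Type*} [Group G] {Z : Subgroup G}
    (hZ : IsVirtuallyInt Z) :
    ∃ g ∈ Z, ¬ IsOfFinOrder g ∧ ∃ F : Set G, F.Finite ∧
      ∀ z ∈ Z, ∃ n : ℤ, ∃ f ∈ F, z = g ^ n * f := by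
  obtain ⟨M, hM, ⟨e⟩⟩ := hZ
  set m : M := e.symm (Multiplicative.ofAdd 1) with hm
  have hpow : ∀ x : M, ∃ n : ℤ, x = m ^ n := by
    intro x
    refine ⟨(e x).toAdd, ?_⟩
    rw [hm, ← map_zpow, ← ofAdd_zsmul, smul_eq_mul, mul_one, ofAdd_toAdd, e.symm_apply_apply]
  refine ⟨((m : Z) : G), (m : Z).2, ?_, Set.range fun q : Z ⧸ M => ((q.out⁻¹ : Z) : G),
    Set.finite_range _, fun z hz => ?_⟩
  · rw [Submonoid.isOfFinOrder_coe, Submonoid.isOfFinOrder_coe]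
    intro h
    have h1 := e.toMonoidHom.isOfFinOrder h
    rw [MulEquiv.toMonoidHom_eq_coe, MonoidHom.coe_coe, hm, e.apply_symm_apply,
      isOfFinOrder_ofAdd_iff, isOfFinAddOrder_iff_nsmul_eq_zero] at h1
    obtain ⟨n, hn, h1⟩ := h1
    simp at h1
    omega
  -- Taking the left coset of the inverse of `z` puts the power of the generator on the left of `z`.
  · set q : Z ⧸ M := QuotientGroup.mk (⟨z, hz⟩⁻¹ : Z) with hq
    have hqm : q.out⁻¹ * (⟨z, hz⟩⁻¹ : Z) ∈ M := by
      rw [← QuotientGroup.eq]; simp [hq]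
    obtain ⟨n, hn⟩ := hpow ⟨_, hqm⟩
    refine ⟨-n, _, ⟨q, rfl⟩, ?_⟩
    have h1 := congrArg (fun x : M => ((x : Z) : G)) hn
    simp only [Subgroup.coe_mul, Subgroup.coe_inv, Subgroup.coe_zpow] at h1
    rw [zpow_neg, ← h1]
    simp

theorem IsGeometricAction.exists_dist_smul_le {G X : Type*} [Group G] [MetricSpace X]
    [MulAction G X] (hGX : IsGeometricAction G X) (o : X) :
    ∃ D : ℝ, ∀ x : X, ∃ g : G, dist x (g • o) ≤ D := by
  have : IsIsometricSMul G X := ⟨hGX.isometric⟩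
  have := hGX.cocompact
  let q : X → Quotient (MulAction.orbitRel G X) := Quotient.mk _
  have hq : IsOpenMap q := isOpenMap_quotient_mk'_mul
  obtain ⟨n, hn⟩ := isCompact_univ.elim_directed_cover (fun n : ℕ => q '' Metric.ball o n)
    (fun n => hq _ Metric.isOpen_ball)
    (fun x _ => by
      obtain ⟨x, rfl⟩ := Quotient.exists_rep x
      obtain ⟨n, hn⟩ := exists_nat_gt (dist x o)
      exact Set.mem_iUnion.2 ⟨n, x, hn, rfl⟩)
    (Monotone.directed_le fun m n hmn =>
      Set.image_mono (Metric.ball_subset_ball (by exact_mod_cast hmn)))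
  refine ⟨n, fun x => ?_⟩
  obtain ⟨y, hy, hyx⟩ := hn (Set.mem_univ (q x))
  obtain ⟨g, rfl⟩ : y ∈ MulAction.orbit G x := Quotient.exact hyx
  refine ⟨g⁻¹, ?_⟩
  rw [← dist_smul g, smul_inv_smul]
  exact (Metric.mem_ball.1 hy).le

theorem IsGeometricAction.finite_dist_smul_le {G X : Type*} [Group G] [MetricSpace X]
    [ProperSpace X] [MulAction G X] (hGX : IsGeometricAction G X) (o : X) (R : ℝ) :
    {g : G | dist o (g • o) ≤ R}.Finite := by
  rcases lt_or_ge R 0 with hR | hR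
  · convert Set.finite_empty
    ext g
    simpa using hR.trans_le dist_nonneg
  refine (hGX.proper _ (isCompact_closedBall o R)).subset fun g hg => ?_
  refine ⟨g • o, ⟨o, Metric.mem_closedBall_self hR, rfl⟩, ?_⟩
  rw [Metric.mem_closedBall, dist_comm]; exact hg

/-! ### Ends of a line and the separation of the boundary -/

namespace Bicombing

variable {X : Type*} [MetricSpace X] {σ : Bicombing X} {c : ℝ → X}

/-- The positive half of a `σ`-line. -/
def IsLine.posRay (hc : σ.IsLine c) : σ.Ray :=
  .ofReal σ c (fun s t _ _ => hc.dist_eq s t) fun t ht u hu => by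
    rw [hc.seg_eq 0 t ht u hu]; congr 1; ring

/-- The negative half of a `σ`-line. -/
def IsLine.negRay (hc : σ.IsLine c) (hrev : σ.IsReversible) : σ.Ray :=
  .ofReal σ (fun t => c (-t)) (fun s t _ _ => by
      rw [hc.dist_eq, neg_sub_neg, abs_sub_comm]) fun t ht u hu => by
    have hu' : 1 - u ∈ Set.Icc (0 : ℝ) 1 := ⟨by linarith [hu.2], by linarith [hu.1]⟩
    rw [hrev.seg_symm _ _ hu, hc.seg_eq _ _ (by linarith) _ hu']; congr 1; ring

theorem IsLine.posRay_apply (hc : σ.IsLine c) (t : ℝ≥0) : hc.posRay t = c t := rfl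

theorem IsLine.negRay_apply (hc : σ.IsLine c) (hrev : σ.IsReversible) (t : ℝ≥0) :
    hc.negRay hrev t = c (-t) := rfl

theorem IsLine.posRay_ne_negRay (hc : σ.IsLine c) (hrev : σ.IsReversible) :
    hc.posRay.toBoundary ≠ (hc.negRay hrev).toBoundary := by
  intro h
  obtain ⟨C, hC⟩ : ∃ C : ℝ, ∀ t : ℝ≥0, dist (hc.posRay t) (hc.negRay hrev t) ≤ C :=
    Quotient.exact h
  have h1 := hC (C.toNNReal + 1)
  rw [hc.posRay_apply, hc.negRay_apply, hc.dist_eq, sub_neg_eq_add, abs_of_nonneg (by positivity)]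
    at h1
  push_cast at h1
  have := Real.le_coe_toNNReal C
  have := C.toNNReal.coe_nonneg
  linarith

/-- The distance to a `σ`-line is quasi-convex along rays. -/
theorem IsLine.infDist_le (hσ : σ.IsConical) (hrev : σ.IsReversible) (hc : σ.IsLine c)
    (η : σ.Ray) {s t : ℝ≥0} (hst : s ≤ t) {M : ℝ} (h0 : Metric.infDist (η 0) (Set.range c) ≤ M)
    (ht : Metric.infDist (η t) (Set.range c) ≤ M) : Metric.infDist (η s) (Set.range c) ≤ M := by
  rcases (zero_le : 0 ≤ t).eq_or_lt with rfl | htpos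
  · rwa [le_antisymm hst zero_le]
  have hne := Set.range_nonempty c
  refine le_of_forall_pos_lt_add fun ε hε => ?_
  obtain ⟨_, ⟨a, rfl⟩, ha⟩ := (Metric.infDist_lt_iff hne).1 (h0.trans_lt (lt_add_of_pos_right M hε))
  obtain ⟨_, ⟨b, rfl⟩, hb⟩ := (Metric.infDist_lt_iff hne).1 (ht.trans_lt (lt_add_of_pos_right M hε))
  have hu : (s / t : ℝ) ∈ Set.Icc (0 : ℝ) 1 :=
    ⟨by positivity, div_le_one_of_le₀ (by exact_mod_cast hst) t.2⟩
  have hu' : 1 - (s / t : ℝ) ∈ Set.Icc (0 : ℝ) 1 := ⟨by linarith [hu.2], by linarith [hu.1]⟩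
  have hmem : σ.seg (c a) (c b) (s / t) ∈ Set.range c := by
    rcases le_total a b with hab | hab
    · rw [hc.seg_eq a b hab _ hu]; exact ⟨_, rfl⟩
    · rw [hrev.seg_symm _ _ hu, hc.seg_eq b a hab _ hu']; exact ⟨_, rfl⟩
  refine (Metric.infDist_le_dist_of_mem hmem).trans_lt ?_
  rw [← η.seg_zero_eq hst htpos]
  refine (hσ.dist_seg_le _ _ _ _ hu).trans_lt ?_
  rcases hu.1.eq_or_lt with h | h
  · rw [← h]; linarith
  · nlinarith [mul_lt_mul_of_pos_left hb h, mul_le_mul_of_nonneg_left ha.le hu'.1]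

/-- A ray that stays close to a `σ`-line is asymptotic to one of its halves. -/
theorem IsLine.eq_or_eq_of_infDist_le (hσ : σ.IsConical) (hrev : σ.IsReversible) (hc : σ.IsLine c)
    (η : σ.Ray) {R : ℝ} (hR : ∀ t : ℝ≥0, Metric.infDist (η t) (Set.range c) ≤ R) :
    η.toBoundary = hc.posRay.toBoundary ∨ η.toBoundary = (hc.negRay hrev).toBoundary := by
  have hs : ∀ t : ℝ≥0, ∃ s : ℝ, dist (η t) (c s) < R + 1 := by
    intro t
    obtain ⟨_, ⟨a, rfl⟩, ha⟩ := (Metric.infDist_lt_iff (Set.range_nonempty c)).1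
      ((hR t).trans_lt (lt_add_one R))
    exact ⟨a, ha⟩
  choose s hs using hs
  have hR0 : 0 ≤ R := Metric.infDist_nonneg.trans (hR 0)
  set C := 3 * (R + 1) + |s 0| with hC
  have habs : ∀ t : ℝ≥0, |(|s t| - t)| ≤ 2 * (R + 1) + |s 0| := by
    intro t
    have h1 := dist_triangle4 (η 0) (c (s 0)) (c (s t)) (η t)
    have h2 := dist_triangle4 (c (s 0)) (η 0) (η t) (c (s t))
    rw [η.dist_eq, hc.dist_eq, dist_comm (c (s t))] at h1
    rw [η.dist_eq, hc.dist_eq, dist_comm (c (s 0))] at h2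
    simp only [NNReal.coe_zero, zero_sub, abs_neg, NNReal.abs_eq] at h1 h2
    have h3 := hs 0
    have h4 := hs t
    have h5 : |s t| ≤ |s 0| + |s 0 - s t| := by
      have := abs_sub (s 0) (s 0 - s t); rwa [sub_sub_cancel] at this
    have h6 := abs_sub (s 0) (s t)
    rw [abs_le]; constructor <;> linarith
  have h0 : dist (η 0) (c 0) ≤ C := by
    refine (dist_triangle _ (c (s 0)) _).trans ?_
    rw [hc.dist_eq, sub_zero]; linarith [hs 0]
  -- Since `|s t|` stays close to `t`, the sign of `s t` at arbitrarily large times decides which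
  -- half the ray follows.
  by_cases hpos : ∀ t, ∃ t', t ≤ t' ∧ 0 ≤ s t'
  · left
    refine Quotient.sound ⟨C, η.dist_le_of_frequently hσ hc.posRay (by simpa [posRay_apply]) ?_⟩
    intro t
    obtain ⟨t', htt', ht'⟩ := hpos t
    refine ⟨t', htt', (dist_triangle _ (c (s t')) _).trans ?_⟩
    have := habs t'
    rw [abs_of_nonneg ht'] at this
    rw [posRay_apply, hc.dist_eq]; linarith [hs t']
  · right
    push Not at hpos
    obtain ⟨t₀, ht₀⟩ := hpos
    refine Quotient.sound ⟨C, η.dist_le_of_frequently hσ (hc.negRay hrev)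
      (by simpa [negRay_apply]) ?_⟩
    intro t
    refine ⟨max t t₀, le_max_left _ _, (dist_triangle _ (c (s (max t t₀))) _).trans ?_⟩
    have := habs (max t t₀)
    rw [abs_of_neg (ht₀ _ (le_max_right _ _)), abs_sub_comm, sub_neg_eq_add, add_comm] at this
    rw [negRay_apply, hc.dist_eq, sub_neg_eq_add]; linarith [hs (max t t₀)]

theorem toBoundary_ne_of_unbounded {L : Set X} {η ρ : σ.Ray} (hρ : ∀ t, ρ t ∈ L)
    (h : ∀ C : ℝ, ∃ t, C < Metric.infDist (η t) L) : η.toBoundary ≠ ρ.toBoundary := by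
  intro he
  obtain ⟨C, hC⟩ : ∃ C : ℝ, ∀ t : ℝ≥0, dist (η t) (ρ t) ≤ C := Quotient.exact he
  obtain ⟨t, ht⟩ := h C
  linarith [Metric.infDist_le_dist_of_mem (x := η t) (hρ t), hC t]

/-- `A` and `B` are a unit distance apart outside the `R`-neighbourhood of `L`. -/
def SeparatedOff (L A B : Set X) (R : ℝ) : Prop :=
  ∀ x ∈ A, ∀ y ∈ B, dist x y ≤ 1 → Metric.infDist x L ≤ R ∧ Metric.infDist y L ≤ R

theorem SeparatedOff.symm {L A B : Set X} {R : ℝ} (h : SeparatedOff L A B R) :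
    SeparatedOff L B A R := fun x hx y hy hxy =>
  (h y hy x hx (by rwa [dist_comm])).symm

/-- The ends of the rays from `o` that enter `A` outside the neighbourhood of `L` of radius `M`. -/
def endsIn (σ : Bicombing X) (o : X) (L A : Set X) (M : ℝ) : Set σ.Boundary :=
  {b | ∃ η : σ.Ray, η 0 = o ∧ η.toBoundary = b ∧ ∃ t, M < Metric.infDist (η t) L ∧ η t ∈ A}

/-- A ray within distance `1` of `η` at time `t`, and close enough to remain outside the
`M`-neighbourhood, cannot be on the other side there. -/
theorem isOpen_endsIn {L A B : Set X} {R M : ℝ} (hAB : A ∪ B = Set.univ)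
    (hsep : SeparatedOff L A B R) (hM : R ≤ M) (o : X) :
    @IsOpen _ (σ.boundaryTopology o) (σ.endsIn o L A M) := by
  let := σ.boundaryTopology o
  rw [isOpen_iff_forall_mem_open]
  rintro _ ⟨η, h0, rfl, t, htM, htA⟩
  have hopen : IsOpen {x | M < Metric.infDist x L} :=
    isOpen_lt continuous_const (Metric.continuous_infDist_pt L)
  obtain ⟨ε, hε, hball⟩ := Metric.isOpen_iff.1 hopen _ htM
  refine ⟨σ.basicNhd η t (min ε 1), ?_, ?_, ⟨η, rfl, rfl, by simp [hε]⟩⟩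
  · rintro b ⟨ζ, hζ0, rfl, hζ⟩
    refine ⟨ζ, hζ0.trans h0, rfl, t, hball (hζ.trans_le (min_le_left _ _)), ?_⟩
    by_contra hA
    have hB : ζ t ∈ B := ((hAB ▸ Set.mem_univ (ζ t) : ζ t ∈ A ∪ B)).resolve_left hA
    have := (hsep _ htA _ hB (by
      rw [dist_comm]; exact hζ.le.trans (min_le_right _ _))).1
    linarith
  · exact TopologicalSpace.isOpen_generateFrom_of_mem ⟨η, t, min ε 1, h0, by simp [hε], rfl⟩

theorem IsLine.mem_of_le (hσ : σ.IsConical) (hrev : σ.IsReversible) (hc : σ.IsLine c)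
    {A B : Set X} {R M : ℝ} (hAB : A ∪ B = Set.univ) (hsep : SeparatedOff (Set.range c) A B R)
    (hM : R ≤ M) (η : σ.Ray) (h0 : Metric.infDist (η 0) (Set.range c) ≤ M) {t : ℝ≥0}
    (htM : M < Metric.infDist (η t) (Set.range c)) (htA : η t ∈ A) {t' : ℝ≥0} (htt' : t ≤ t') :
    M < Metric.infDist (η t') (Set.range c) ∧ η t' ∈ A := by
  have hfar : ∀ t' : ℝ≥0, t ≤ t' → M < Metric.infDist (η t') (Set.range c) := by
    intro t' htt'
    by_contra! h
    exact absurd (hc.infDist_le hσ hrev η htt' h0 h) (not_le.2 htM)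
  refine ⟨hfar t' htt', ?_⟩
  -- Separation only excludes crossings between points at distance at most `1`, so time advances in
  -- steps of length at most `1`.
  have step : ∀ n : ℕ, ∀ t' : ℝ≥0, t ≤ t' → t' ≤ t + n → η t' ∈ A := by
    intro n
    induction n with
    | zero =>
      intro t' h1 h2
      rwa [← le_antisymm h1 (by simpa using h2)]
    | succ n ih =>
      intro t' h1 h2
      set s := min t' (t + n) with hs
      have hsA : η s ∈ A := ih s (le_min h1 (by simp)) (min_le_right _ _)
      by_contra hA
      have hB : η t' ∈ B := ((hAB ▸ Set.mem_univ (η t') : η t' ∈ A ∪ B)).resolve_left hA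
      have hd : dist (η s) (η t') ≤ 1 := by
        rw [η.dist_eq, abs_sub_comm, abs_of_nonneg (by simp [hs])]
        rcases min_choice t' (t + n) with h | h
        · rw [hs, h]; simp
        · rw [hs, h]
          have : (t' : ℝ) ≤ t + (n + 1) := by exact_mod_cast h2
          push_cast; linarith
      linarith [(hsep _ hsA _ hB hd).2, hfar t' h1]
  obtain ⟨n, hn⟩ := exists_nat_ge (t' - t)
  exact step n t' htt' (by rwa [tsub_le_iff_left] at hn)

/-- Two sets that cover `X` and are separated off a `σ`-line, and each of which contains the end of
a ray that diverges from the line, make the ends of the line a separating pair. -/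
theorem IsLine.isSeparatingPair [CompleteSpace X] (hσ : σ.IsCCC) (hrev : σ.IsReversible)
    (hc : σ.IsLine c) {A B : Set X} {R : ℝ} (hAB : A ∪ B = Set.univ)
    (hsep : SeparatedOff (Set.range c) A B R) (ξ ζ : σ.Ray)
    (hξ : ∀ C : ℝ, ∃ t, ∀ x, dist x (ξ t) ≤ C → x ∉ B ∧ C < Metric.infDist x (Set.range c))
    (hζ : ∀ C : ℝ, ∃ t, ∀ x, dist x (ζ t) ≤ C → x ∉ A ∧ C < Metric.infDist x (Set.range c))
    (o : X) :
    IsSeparatingPair (σ.boundaryTopology o) hc.posRay.toBoundary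
      (hc.negRay hrev).toBoundary := by
  refine ⟨hc.posRay_ne_negRay hrev, fun hconn => ?_⟩
  set L := Set.range c with hL
  set M := max R (Metric.infDist o L) with hM
  have hRM : R ≤ M := le_max_left _ _
  have hoM : Metric.infDist o L ≤ M := le_max_right _ _
  have hBA : B ∪ A = Set.univ := by rw [Set.union_comm, hAB]
  -- The ray from `o` asymptotic to `ξ` stays within `dist o (ξ 0)` of it, so the hypothesis on
  -- balls around `ξ t` applies to its points.
  have nonempty : ∀ (A B : Set X) (ξ : σ.Ray), A ∪ B = Set.univ →
      (∀ C : ℝ, ∃ t, ∀ x, dist x (ξ t) ≤ C → x ∉ B ∧ C < Metric.infDist x L) →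
      (({hc.posRay.toBoundary, (hc.negRay hrev).toBoundary}ᶜ : Set σ.Boundary) ∩
        σ.endsIn o L A M).Nonempty := by
    intro A B ξ hAB hξ
    obtain ⟨η, hη0, hη⟩ := ξ.exists_asymptotic hσ o
    have hfar : ∀ C : ℝ, ∃ t, C < Metric.infDist (η t) L ∧ η t ∈ A := by
      intro C
      obtain ⟨t, ht⟩ := hξ (max C (dist o (ξ 0)))
      obtain ⟨h1, h2⟩ := ht (η t) ((hη t).trans (le_max_right _ _))
      exact ⟨t, (le_max_left _ _).trans_lt h2,
        ((hAB ▸ Set.mem_univ (η t) : η t ∈ A ∪ B)).resolve_right h1⟩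
    have hfar' : ∀ C : ℝ, ∃ t, C < Metric.infDist (η t) L := fun C =>
      (hfar C).imp fun _ h => h.1
    refine ⟨η.toBoundary, ?_, η, hη0, rfl, hfar M⟩
    rintro (h | h)
    · exact toBoundary_ne_of_unbounded (ρ := hc.posRay) (fun t => Set.mem_range_self (f := c) t) hfar' h
    · exact toBoundary_ne_of_unbounded (ρ := hc.negRay hrev)
        (fun t => Set.mem_range_self (f := c) (-t)) hfar' h
  obtain ⟨b, -, ⟨η, hη0, rfl, t, htM, htA⟩, η', hη'0, hη', t', htM', htB⟩ :=
    hconn (σ.endsIn o L A M) (σ.endsIn o L B M) (isOpen_endsIn hAB hsep hRM o)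
      (isOpen_endsIn hBA hsep.symm hRM o) (fun b hb => by
        obtain ⟨η, rfl⟩ : ∃ η : σ.Ray, η.toBoundary = b := Quotient.exists_rep b
        obtain ⟨ξ, hξ0, hξ⟩ := η.exists_asymptotic hσ o
        have hξη : ξ.toBoundary = η.toBoundary := Quotient.sound ⟨_, hξ⟩
        by_contra hcon
        have hnear : ∀ t : ℝ≥0, Metric.infDist (ξ t) L ≤ M := by
          intro t
          by_contra! h
          rcases (hAB ▸ Set.mem_univ (ξ t) : ξ t ∈ A ∪ B) with h' | h'
          · exact hcon (Or.inl ⟨ξ, hξ0, hξη, t, h, h'⟩)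
          · exact hcon (Or.inr ⟨ξ, hξ0, hξη, t, h, h'⟩)
        have := hc.eq_or_eq_of_infDist_le hσ.2 hrev ξ hnear
        rw [hξη] at this
        exact hb this)
      (nonempty A B ξ hAB hξ) (nonempty B A ζ hBA hζ)
  -- A common end would have a single ray from `o`, lying far from the line in both `A` and `B` at
  -- time `max t t'`.
  have h1 := hc.mem_of_le hσ.2 hrev hAB hsep hRM η (by rwa [hη0]) htM htA (le_max_left t t')
  have h2 := hc.mem_of_le hσ.2 hrev hBA hsep.symm hRM η' (by rwa [hη'0]) htM' htB
    (le_max_right t t')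
  rw [← η.eq_of_asymptotic hσ.2 η' (hη0.trans hη'0.symm) hη'.symm] at h2
  linarith [(hsep _ h1.2 _ h2.2 (by simp)).1, h1.1]

end Bicombing

/-! ### The two sides of the axis -/

namespace Bicombing

variable {X : Type*} [MetricSpace X] {G : Type*} [Group G] [MulAction G X] [IsIsometricSMul G X]
  {σ : Bicombing X} {Z : Subgroup G} {U : Set G} {o : X} {D : ℝ} {c : ℝ → X} {γ : G} {l : ℝ}

/-- The points within distance `D` of the part `U • o` of the orbit of `o`. -/
def orbitNhd (U : Set G) (o : X) (D : ℝ) : Set X := {x | ∃ g ∈ U, dist x (g • o) ≤ D}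

/-- The element `g⁻¹ * g'` moves `o` by at most `R`, so it takes finitely many values. -/
theorem exists_finite_of_coboundary
    (hprop : ∀ R : ℝ, {g : G | dist o (g • o) ≤ R}.Finite)
    (hU : ∀ k, ∃ F : Set G, F.Finite ∧
      ∀ g, ¬ (g * k ∈ U ↔ g ∈ U) → ∃ z ∈ Z, ∃ f ∈ F, g = z * f) (R : ℝ) :
    ∃ F : Set G, F.Finite ∧ ∀ g ∈ U, ∀ g' ∈ Uᶜ, dist (g • o) (g' • o) ≤ R →
      ∃ z ∈ Z, ∃ f ∈ F, g = z * f := by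
  choose F hF hF' using hU
  refine ⟨⋃ k ∈ {g : G | dist o (g • o) ≤ R}, F k, (hprop R).biUnion fun k _ => hF k,
    fun g hg g' hg' hd => ?_⟩
  obtain ⟨z, hz, f, hf, he⟩ := hF' (g⁻¹ * g') g (by
    rw [mul_inv_cancel_left]; exact fun h => hg' (h.2 hg))
  refine ⟨z, hz, f, Set.mem_biUnion (x := g⁻¹ * g') ?_ hf, he⟩
  change dist _ _ ≤ R
  rwa [← dist_smul g, mul_smul, smul_inv_smul]

theorem infDist_zpow_smul_le (hγ : ∀ k : ℤ, c (k * l) = γ ^ k • c 0) (k : ℤ) (p : X) :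
    Metric.infDist (γ ^ k • p) (Set.range c) ≤ dist p (c 0) := by
  have h := Metric.infDist_le_dist_of_mem (x := γ ^ k • p) (Set.mem_range_self (f := c) (k * l))
  rwa [hγ, dist_smul] at h

/-- Close points on opposite sides are near `g • o` with `g = γ ^ n * e * f`, where `e` and `f`
range over finite sets; translating by `γ ^ (-n)` bounds the distance to the axis. -/
theorem exists_separatedOff
    (hprop : ∀ R : ℝ, {g : G | dist o (g • o) ≤ R}.Finite)
    (hU : ∀ k, ∃ F : Set G, F.Finite ∧
      ∀ g, ¬ (g * k ∈ U ↔ g ∈ U) → ∃ z ∈ Z, ∃ f ∈ F, g = z * f)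
    (hZ : ∃ F : Set G, F.Finite ∧ ∀ z ∈ Z, ∃ n : ℤ, ∃ f ∈ F, z = γ ^ n * f)
    (hγ : ∀ k : ℤ, c (k * l) = γ ^ k • c 0) (D : ℝ) :
    ∃ R, SeparatedOff (Set.range c) (orbitNhd U o D) (orbitNhd Uᶜ o D) R := by
  obtain ⟨F, hF, hF'⟩ := exists_finite_of_coboundary hprop hU (2 * D + 1)
  obtain ⟨E, hE, hE'⟩ := hZ
  obtain ⟨R, hR⟩ := ((hE.mul hF).image fun g => dist (g • o) (c 0)).bddAbove
  refine ⟨R + D + 1, ?_⟩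
  rintro x ⟨g, hg, hx⟩ y ⟨g', hg', hy⟩ hxy
  have hd : dist (g • o) (g' • o) ≤ 2 * D + 1 := by
    have := dist_triangle4 (g • o) x y (g' • o)
    rw [dist_comm _ x] at this
    linarith
  obtain ⟨z, hz, f, hf, rfl⟩ := hF' g hg g' hg' hd
  obtain ⟨n, e, he, rfl⟩ := hE' z hz
  have h1 : Metric.infDist ((γ ^ n * e * f) • o) (Set.range c) ≤ R := by
    rw [mul_assoc, mul_smul]
    exact (infDist_zpow_smul_le hγ n _).trans (hR ⟨_, Set.mul_mem_mul he hf, rfl⟩)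
  have h2 := Metric.infDist_le_infDist_add_dist (s := Set.range c) (x := x)
    (y := (γ ^ n * e * f) • o)
  have h3 := Metric.infDist_le_infDist_add_dist (s := Set.range c) (x := y) (y := x)
  rw [dist_comm y x] at h3
  constructor <;> linarith

/-- The axis of an element whose positive powers lie in `U` and not in `Z` has a half that diverges
from the axis of an element of `Z`, and from the complement of `U`. -/
theorem exists_diverging_ray [ProperSpace X] (hσ : σ.IsCCC) (heq : σ.IsEquivariant G)
    (hD : ∀ x : X, ∃ g : G, dist x (g • o) ≤ D)
    (hprop : ∀ R : ℝ, {g : G | dist o (g • o) ≤ R}.Finite)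
    (hU : ∀ k, ∃ F : Set G, F.Finite ∧
      ∀ g, ¬ (g * k ∈ U ↔ g ∈ U) → ∃ z ∈ Z, ∃ f ∈ F, g = z * f)
    (hγZ : γ ∈ Z) (hl : 0 < l) (hc : σ.IsLine c) (hγ : ∀ k : ℤ, c (k * l) = γ ^ k • c 0)
    {h : G} (hh : ∀ n : ℕ, h ^ (n + 1) ∉ Z ∧ h ^ (n + 1) ∈ U) :
    ∃ ξ : σ.Ray, ∀ C : ℝ, ∃ t, ∀ x, dist x (ξ t) ≤ C →
      x ∉ orbitNhd Uᶜ o D ∧ C < Metric.infDist x (Set.range c) := by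
  have hord : ¬ IsOfFinOrder h := by
    rw [isOfFinOrder_iff_pow_eq_one]
    rintro ⟨n, hn, h1⟩
    apply (hh (n - 1)).1
    rw [Nat.sub_add_cancel hn, h1]; exact Z.one_mem
  obtain ⟨c', l', hl', hc', hh'⟩ := exists_axis hσ heq o hD hprop hord
  refine ⟨hc'.posRay, fun C => ?_⟩
  set y := c' 0 with hy
  obtain ⟨F, hF, hF'⟩ := exists_finite_of_coboundary hprop hU (dist o y + C + D)
  -- `F` excludes points near the orbit of `Uᶜ`. The second set excludes points near the axis: its
  -- radius adds the distances along `h ^ (n + 1) • o`, `x`, `c s`, `c (k * l)`, `γ ^ k • o`.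
  set E := F ∪ {g : G | dist o (g • o) ≤ dist o y + 2 * C + 1 + l + dist (c 0) o} with hE
  have hEfin : E.Finite := hF.union (hprop _)
  -- If all positive powers of `h` lay in `Z * E`, two would share the factor in `E`, and their
  -- quotient would be a positive power of `h` in `Z`.
  obtain ⟨n, hn⟩ : ∃ n : ℕ, ¬ ∃ z ∈ Z, ∃ f ∈ E, h ^ (n + 1) = z * f := by
    by_contra! hcon
    choose z hz f hf he using hcon
    obtain ⟨m, n, hmn, hfe⟩ : ∃ m n, m < n ∧ f m = f n :=
      Set.Finite.exists_lt_map_eq_of_forall_mem hf hEfin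
    apply (hh (n - m - 1)).1
    have h1 : h ^ (n - m - 1 + 1) = z n * (z m)⁻¹ := by
      rw [eq_mul_inv_iff_mul_eq, ← mul_left_inj (f m), mul_assoc, ← he m, hfe, ← he n, ← pow_add]
      congr 1; omega
    rw [h1]; exact Z.mul_mem (hz n) (Z.inv_mem (hz m))
  refine ⟨(n + 1 : ℕ) * l'.toNNReal, fun x hx => ?_⟩
  have hpt : hc'.posRay ((n + 1 : ℕ) * l'.toNNReal) = h ^ (n + 1) • y := by
    have := hh' (n + 1 : ℕ)
    rw [zpow_natCast] at this
    rw [← this, hc'.posRay_apply, NNReal.coe_mul, Real.coe_toNNReal _ hl'.le]; rfl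
  rw [hpt] at hx
  have hx' : dist (h ^ (n + 1) • o) x ≤ dist o y + C := by
    have := dist_triangle (h ^ (n + 1) • o) (h ^ (n + 1) • y) x
    rw [dist_smul, dist_comm _ x, dist_comm (h ^ (n + 1) • y)] at this
    rw [dist_comm]; linarith
  constructor
  · rintro ⟨g, hg, hxg⟩
    obtain ⟨z, hz, f, hf, he⟩ := hF' _ (hh n).2 g hg
      ((dist_triangle _ x _).trans (add_le_add hx' hxg))
    exact hn ⟨z, hz, f, Or.inl hf, he⟩
  · by_contra! hle
    obtain ⟨_, ⟨s, rfl⟩, hs⟩ := (Metric.infDist_lt_iff (Set.range_nonempty c)).1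
      (hle.trans_lt (lt_add_one C))
    set k := ⌊s / l⌋ with hk
    have hks : dist (c s) (c (k * l)) ≤ l := by
      have h1 := Int.floor_le (s / l)
      have h2 := Int.lt_floor_add_one (s / l)
      rw [le_div_iff₀ hl] at h1
      rw [div_lt_iff₀ hl] at h2
      rw [hc.dist_eq, abs_of_nonneg (by linarith)]
      linarith
    refine hn ⟨γ ^ k, Z.zpow_mem hγZ k, (γ ^ k)⁻¹ * h ^ (n + 1), Or.inr ?_, by simp⟩
    change dist _ _ ≤ _
    rw [← dist_smul (γ ^ k), mul_smul, smul_inv_smul]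
    have h1 := dist_triangle4 (h ^ (n + 1) • o) x (c s) (c (k * l))
    have h2 := dist_triangle (h ^ (n + 1) • o) (c (k * l)) (γ ^ k • o)
    rw [hγ k, dist_smul] at h2
    rw [hγ k] at h1 hks
    rw [dist_comm]
    linarith

end Bicombing

theorem propositionp {G : Type*} [Group G] (G₁ G₂ Z : Subgroup G)
    (hG : IsAmalgamatedProduct G₁ G₂ Z) (h₁ : G₁ ≠ Z) (h₂ : G₂ ≠ Z) (hZ : IsVirtuallyInt Z)
    {X : Type*} [MetricSpace X] [ProperSpace X] [Nonempty X] [MulAction G X]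
    (hGX : IsGeometricAction G X)
    (σ : Bicombing X) (hσ : σ.IsCCC) (hrev : σ.IsReversible) (hequiv : σ.IsEquivariant G) :
    ∃ a b : σ.Boundary, ∀ o : X, IsSeparatingPair (σ.boundaryTopology o) a b := by
  have : IsIsometricSMul G X := ⟨hGX.isometric⟩
  obtain ⟨p⟩ := ‹Nonempty X›
  obtain ⟨D, hD⟩ := hGX.exists_dist_smul_le p
  have hprop := hGX.finite_dist_smul_le p
  obtain ⟨γ, hγZ, hγ, hZF⟩ := hZ.exists_zpow_mul
  obtain ⟨U, hU, ⟨g, hg⟩, ⟨h, hh⟩⟩ := hG.exists_almostInvariant h₁ h₂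
  obtain ⟨c, l, hl, hc, hcγ⟩ := Bicombing.exists_axis hσ hequiv p hD hprop hγ
  have hU' : ∀ k, ∃ F : Set G, F.Finite ∧
      ∀ g, ¬ (g * k ∈ Uᶜ ↔ g ∈ Uᶜ) → ∃ z ∈ Z, ∃ f ∈ F, g = z * f := by
    simpa only [Set.mem_compl_iff, not_iff_not] using hU
  obtain ⟨R, hR⟩ := Bicombing.exists_separatedOff hprop hU hZF hcγ D
  obtain ⟨ξ, hξ⟩ := Bicombing.exists_diverging_ray hσ hequiv hD hprop hU hγZ hl hc hcγ hg
  obtain ⟨ζ, hζ⟩ := Bicombing.exists_diverging_ray hσ hequiv hD hprop hU' hγZ hl hc hcγ hh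
  rw [compl_compl] at hζ
  refine ⟨_, _, hc.isSeparatingPair hσ hrev ?_ hR ξ ζ hξ hζ⟩
  refine Set.eq_univ_of_forall fun x => ?_
  obtain ⟨g, hx⟩ := hD x
  by_cases hgU : g ∈ U
  · exact Or.inl ⟨g, hgU, hx⟩
  · exact Or.inr ⟨g, hgU, hx⟩
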